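/- Let $G=(V,E)$ be a finite simple undirected graph and $\prec$ a linear order on $V$. Two edges $uv$, $wx$ with $u\prec v$, $w\prec x$, $u\prec w$ \emph{cross} if $u\prec w\prec v\prec x$, and $wx$ is \emph{nested} by $uv$ if $u\prec w\prec x\prec v$. For integers $s,q\ge 0$, an \emph{$s$-stack $q$-queue layout of $G$ respecting $\prec$} is an assignment of the edges of $G$ to $s$ stack pages and $q$ queue pages (pages may be empty) such that no two edges on the same stack page cross and no two edges on the same queue page are nested. Consider the decision problem $\mathrm{MIX}(s,q)$, for fixed $s,q$: given a finite simple undirected graph $G$ together with a linear order $\prec$ of its vertices, decide whether $G$ admits an $s$-stack $q$-queue layout respecting $\prec$. \textbf{Theorem 2.} For all integers $s,q\ge 0$: if $\mathrm{MIX}(s,q)$ is NP-complete, then (i) $\mathrm{MIX}(s,q+1)$ is NP-complete and (ii) $\mathrm{MIX}(s+1,q)$ is NP-complete. (NP-completeness is with respect to polynomial-time many-one reductions.) -/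

import Mathlib

/-! ### Polynomial time, NP and NP-completeness

The machine model is Mathlib's multi-stack Turing machine `Turing.FinTM2` (finitely many stacks,
control labels and internal states, a step count), and polynomial-time computability is Mathlib's
`Turing.TM2ComputableInPolyTime`.  A decision problem is a predicate `P : α → Prop` on a type `α`
of instances together with an encoding `ea : α → List Γ` of the instances as strings. -/

/-- The string `x # w` which hands an instance and a certificate to a verifier;
the separator `#` is `none`. -/
def encodeWithCertificate {α Γ : Type} (ea : α → List Γ) (p : α × List Bool) :
    List (Option (Γ ⊕ Bool)) :=
  (ea p.1).map (fun c => some (Sum.inl c)) ++ none :: p.2.map (fun b => some (Sum.inr b))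

/-- The problem `P` is in NP: there are a polynomial-time verifier `V` and a polynomial `p` such
that the yes-instances are exactly the instances `x` for which `V` accepts `x` together with some
certificate of length at most `p (|x|)`. -/
def InNP {α Γ : Type} (ea : α → List Γ) (P : α → Prop) : Prop :=
  ∃ (V : α × List Bool → Bool) (p : Polynomial ℕ),
    Nonempty (Turing.TM2ComputableInPolyTime
      (encodeWithCertificate ea) Computability.encodeBool V) ∧
    ∀ x, P x ↔ ∃ w : List Bool, w.length ≤ p.eval (ea x).length ∧ V (x, w) = true

/-- Polynomial-time many-one (Karp) reducibility of `P` to `Q`. -/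
def PolyTimeReducible {α β Γ Δ : Type} (ea : α → List Γ) (P : α → Prop)
    (eb : β → List Δ) (Q : β → Prop) : Prop :=
  ∃ f : α → β, Nonempty (Turing.TM2ComputableInPolyTime ea eb f) ∧ ∀ x, P x ↔ Q (f x)

/-- The problem `Q` is NP-hard: every language over `{0, 1}` in NP reduces to it. -/
def NPHard {β Δ : Type} (eb : β → List Δ) (Q : β → Prop) : Prop :=
  ∀ A : List Bool → Prop, InNP (fun x : List Bool => x) A →
    PolyTimeReducible (fun x : List Bool => x) A eb Q

/-- The problem `Q` is NP-complete. -/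
def NPComplete {β Δ : Type} (eb : β → List Δ) (Q : β → Prop) : Prop :=
  InNP eb Q ∧ NPHard eb Q

/-! ### Mixed linear layouts -/

/-- The edges `e = uv` and `f = wx` cross, `e` being the one that starts first:
`u ≺ w ≺ v ≺ x`. -/
def EdgesCross {V : Type*} [LinearOrder V] (e f : Sym2 V) : Prop :=
  ∃ u v w x : V, e = s(u, v) ∧ f = s(w, x) ∧ u < w ∧ w < v ∧ v < x

/-- The edge `f = wx` is nested by the edge `e = uv`: `u ≺ w ≺ x ≺ v`. -/
def EdgeNests {V : Type*} [LinearOrder V] (e f : Sym2 V) : Prop :=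
  ∃ u v w x : V, e = s(u, v) ∧ f = s(w, x) ∧ u < w ∧ w < x ∧ x < v

/-- `G` admits an `s`-stack `q`-queue layout respecting the given order of its vertices: its edges
can be assigned to `s` stack pages and `q` queue pages such that no two edges on the same stack
page cross and no two edges on the same queue page are nested. -/
def HasMixedLayout {V : Type*} [LinearOrder V] (G : SimpleGraph V) (s q : ℕ) : Prop :=
  ∃ page : G.edgeSet → Fin s ⊕ Fin q,
    (∀ (i : Fin s) (e f : G.edgeSet),
      page e = Sum.inl i → page f = Sum.inl i → ¬ EdgesCross e.1 f.1) ∧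
    (∀ (j : Fin q) (e f : G.edgeSet),
      page e = Sum.inr j → page f = Sum.inr j → ¬ EdgeNests e.1 f.1)

/-! ### The decision problem -/

/-- An instance: a finite simple graph with a fixed vertex order.  A vertex is named by its position
in the order, so the order is that of `Fin n`; every edge is listed exactly once, smaller endpoint
first, and the edges may be listed in any order. -/
structure OrderedGraph : Type where
  /-- the number of vertices -/
  n : ℕ
  /-- the list of the edges -/
  edges : List (Fin n × Fin n)
  /-- the smaller endpoint comes first -/
  lt_of_mem : ∀ e ∈ edges, e.1 < e.2
  /-- no edge is listed twice -/
  nodup : edges.Nodup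

/-- The simple undirected graph of an instance. -/
def OrderedGraph.graph (I : OrderedGraph) : SimpleGraph (Fin I.n) :=
  SimpleGraph.fromRel (fun u v => (u, v) ∈ I.edges)

/-- The number `k` written in unary: `1…10` with `k` ones. -/
def encodeUnary (k : ℕ) : List Bool :=
  List.replicate k true ++ [false]

/-- The binary string of an instance: the number of vertices, followed by the two endpoints of each
edge, all in unary. -/
def OrderedGraph.encode (I : OrderedGraph) : List Bool :=
  encodeUnary I.n ++ I.edges.flatMap (fun e => encodeUnary e.1 ++ encodeUnary e.2)

/-- The problem of deciding whether a graph admits an `s`-stack `q`-queue layout that respects the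
given vertex order. -/
def FixedOrderMixedLayout (s q : ℕ) (I : OrderedGraph) : Prop :=
  HasMixedLayout I.graph s q

/-!
Both reductions add to an instance a gadget that consumes one page. For a queue page the gadget is a
*twist*: `s + 1` pairwise crossing edges that enclose the given graph. Two of them cannot share a
stack page, so one is on a queue page, and this page is then closed to all edges that it encloses;
conversely a twist fits on a queue page of its own (`exists_isPaging_twist`).

For a stack page every vertex is followed by `q + 1` new ones, and the gadget consists of `s + 1`
families of nested edges, edges of different families crossing: a *long rainbow*, which joins all
old and new vertices to further ones on the right, and `s` short rainbows of `q + 1` edges. Among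
`q + 1` nested edges one is on a stack page. So the short rainbows occupy `s` different stack pages,
the edges of the long rainbow that are on stack pages are all on the remaining one, and as every
given edge is crossed by `q + 1` consecutive edges of the long rainbow, no given edge is on that
page. Conversely the long rainbow fits on a stack page of its own, and each short rainbow fits on
one of the old stack pages, as it lies to the right of the given graph (`exists_isPaging_rainbows`).

Membership in NP does not come from the hypothesis, which speaks of other numbers of pages. A
certificate lists the pages of the edges in unary, and the verifier keeps one stack for each page,
with the edges put there so far, against which it checks the next edge
(`inNP_fixedOrderMixedLayout`). NP-hardness is inherited along reductions because the composition
of polynomial-time computable functions is polynomial-time computable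
(`TM2ComputableInPolyTime.comp`); the size of the intermediate result is bounded because a machine
pushes a bounded number of symbols per step.

The machines are built from fragments of structured programs (`Prog`), each with a specification
`Prog.Runs` that gives its effect on the stacks and a bound for its number of steps.
-/

open Turing StateTransition Function

/-! ### Programs for multi-stack machines -/

/-- `b` is reached from `a` by at most `t` steps of `f`. -/
def ReachesWithin {α : Type} (f : α → Option α) (t : ℕ) (a b : α) : Prop :=
  ∃ n ≤ t, (flip bind f)^[n] (some a) = some b

namespace ReachesWithin

variable {α : Type} {f : α → Option α} {a b c : α} {t t' : ℕ}

theorem refl : ReachesWithin f 0 a a := ⟨0, le_rfl, rfl⟩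

theorem mono (h : ReachesWithin f t a b) (ht : t ≤ t') : ReachesWithin f t' a b :=
  let ⟨n, hn, e⟩ := h
  ⟨n, hn.trans ht, e⟩

theorem trans (h : ReachesWithin f t a b) (h' : ReachesWithin f t' b c) :
    ReachesWithin f (t + t') a c := by
  obtain ⟨n, hn, e⟩ := h
  obtain ⟨m, hm, e'⟩ := h'
  exact ⟨m + n, by omega, by rw [Function.iterate_add_apply, e, e']⟩

theorem head (h : f a = some b) (h' : ReachesWithin f t b c) : ReachesWithin f (t + 1) a c := by
  obtain ⟨n, hn, e⟩ := h'
  refine ⟨n + 1, by omega, ?_⟩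
  rw [Function.iterate_succ_apply, ← e]
  exact congrArg _ h

end ReachesWithin

/-- A program fragment for machines with stack alphabets `Γ` and internal states `σ`.  It owns the
labels `Lbl`; given names `ι` for them in the set of labels of a machine and a statement `k` with
which to go on after the fragment, `entry ι k` is the statement that starts the fragment and
`code ι k l` the one that has to be placed at the label `ι l`. -/
structure Prog {K : Type} (Γ : K → Type) (σ : Type) : Type 1 where
  /-- the labels of the fragment -/
  Lbl : Type
  /-- there are finitely many labels -/
  fin : Fintype Lbl
  /-- the statement that starts the fragment -/
  entry : {Λ : Type} → (Lbl → Λ) → TM2.Stmt Γ Λ σ → TM2.Stmt Γ Λ σ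
  /-- the statement at a label -/
  code : {Λ : Type} → (Lbl → Λ) → TM2.Stmt Γ Λ σ → Lbl → TM2.Stmt Γ Λ σ

namespace Prog

variable {K : Type} {Γ : K → Type} {σ : Type}

/-- A fragment without labels of its own. -/
def straight (f : {Λ : Type} → TM2.Stmt Γ Λ σ → TM2.Stmt Γ Λ σ) : Prog Γ σ where
  Lbl := Empty
  fin := inferInstance
  entry _ k := f k
  code _ _ l := l.elim

/-- Push a symbol. -/
def push (k : K) (f : σ → Γ k) : Prog Γ σ := straight (TM2.Stmt.push k f)

/-- Pop a symbol, and update the internal state with it. -/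
def pop (k : K) (f : σ → Option (Γ k) → σ) : Prog Γ σ := straight (TM2.Stmt.pop k f)

/-- Update the internal state with the top symbol of a stack. -/
def peek (k : K) (f : σ → Option (Γ k) → σ) : Prog Γ σ := straight (TM2.Stmt.peek k f)

/-- Update the internal state. -/
def load (f : σ → σ) : Prog Γ σ := straight (TM2.Stmt.load f)

/-- Do nothing. -/
def skip : Prog Γ σ := straight id

/-- Run `p`, then `q`. -/
def seq (p q : Prog Γ σ) : Prog Γ σ where
  Lbl := p.Lbl ⊕ q.Lbl
  fin := letI := p.fin; letI := q.fin; inferInstance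
  entry ι k := p.entry (ι ∘ Sum.inl) (q.entry (ι ∘ Sum.inr) k)
  code ι k := Sum.elim (p.code (ι ∘ Sum.inl) (q.entry (ι ∘ Sum.inr) k)) (q.code (ι ∘ Sum.inr) k)

/-- Run `p` or `q`, according to the condition `c`. -/
def branch (c : σ → Bool) (p q : Prog Γ σ) : Prog Γ σ where
  Lbl := p.Lbl ⊕ q.Lbl
  fin := letI := p.fin; letI := q.fin; inferInstance
  entry ι k := TM2.Stmt.branch c (p.entry (ι ∘ Sum.inl) k) (q.entry (ι ∘ Sum.inr) k)
  code ι k := Sum.elim (p.code (ι ∘ Sum.inl) k) (q.code (ι ∘ Sum.inr) k)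

/-- Run `p`; if the condition `c` holds then run `q` and start again, otherwise stop. -/
def loop (p : Prog Γ σ) (c : σ → Bool) (q : Prog Γ σ) : Prog Γ σ where
  Lbl := Option (p.Lbl ⊕ q.Lbl)
  fin := letI := p.fin; letI := q.fin; inferInstance
  entry ι _ := TM2.Stmt.goto fun _ => ι none
  code ι k l :=
    let again : TM2.Stmt Γ _ σ := TM2.Stmt.goto fun _ => ι none
    let rest := TM2.Stmt.branch c (q.entry (ι ∘ some ∘ Sum.inr) again) k
    match l with
    | none => p.entry (ι ∘ some ∘ Sum.inl) rest
    | some (Sum.inl l) => p.code (ι ∘ some ∘ Sum.inl) rest l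
    | some (Sum.inr l) => q.code (ι ∘ some ∘ Sum.inr) again l

variable [DecidableEq K]

/-- Started in the state `v` with stacks `S`, the fragment `p` ends in the state `v'` with stacks
`S'` after at most `t` steps, in whatever machine it is placed. -/
def Runs (p : Prog Γ σ) (v : σ) (S : ∀ k, List (Γ k)) (v' : σ) (S' : ∀ k, List (Γ k)) (t : ℕ) :
    Prop :=
  ∀ (Λ : Type) (M : Λ → TM2.Stmt Γ Λ σ) (ι : p.Lbl → Λ) (k : TM2.Stmt Γ Λ σ),
    (∀ l, M (ι l) = p.code ι k l) →
      ReachesWithin (TM2.step M) t (TM2.stepAux (p.entry ι k) v S) (TM2.stepAux k v' S')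

section rules

variable {p q : Prog Γ σ} {v v' v'' v₃ : σ} {S S' S'' S₃ : ∀ k, List (Γ k)} {t t' t'' : ℕ}

theorem Runs.mono (h : Runs p v S v' S' t) (ht : t ≤ t') : Runs p v S v' S' t' :=
  fun Λ M ι k hM => (h Λ M ι k hM).mono ht

theorem Runs.cast (h : Runs p v S v' S' t) (hv : v' = v'') (hS : S' = S'') (ht : t ≤ t') :
    Runs p v S v'' S'' t' := by
  subst hv hS
  exact h.mono ht

theorem runs_push (k : K) (f : σ → Γ k) : Runs (push k f) v S v (update S k (f v :: S k)) 0 :=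
  fun _ _ _ _ _ => .refl

theorem runs_pop (k : K) (f : σ → Option (Γ k) → σ) :
    Runs (pop k f) v S (f v (S k).head?) (update S k (S k).tail) 0 :=
  fun _ _ _ _ _ => .refl

theorem runs_peek (k : K) (f : σ → Option (Γ k) → σ) :
    Runs (peek k f) v S (f v (S k).head?) S 0 :=
  fun _ _ _ _ _ => .refl

theorem runs_load (f : σ → σ) : Runs (load f) v S (f v) S 0 :=
  fun _ _ _ _ _ => .refl

theorem runs_skip : Runs skip v S v S 0 :=
  fun _ _ _ _ _ => .refl

theorem Runs.seq (h : Runs p v S v' S' t) (h' : Runs q v' S' v'' S'' t') :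
    Runs (seq p q) v S v'' S'' (t + t') := fun Λ M ι k hM =>
  (h Λ M (ι ∘ Sum.inl) (q.entry (ι ∘ Sum.inr) k) fun l => hM (Sum.inl l)).trans
    (h' Λ M (ι ∘ Sum.inr) k fun l => hM (Sum.inr l))

theorem Runs.branch_true {c : σ → Bool} (hc : c v = true) (h : Runs p v S v' S' t) :
    Runs (branch c p q) v S v' S' t := fun Λ M ι k hM => by
  have := h Λ M (ι ∘ Sum.inl) k fun l => hM (Sum.inl l)
  simpa [branch, hc] using this

theorem Runs.branch_false {c : σ → Bool} (hc : c v = false) (h : Runs q v S v' S' t) :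
    Runs (branch c p q) v S v' S' t := fun Λ M ι k hM => by
  have := h Λ M (ι ∘ Sum.inr) k fun l => hM (Sum.inr l)
  simpa [branch, hc] using this

theorem Runs.loop_exit {c : σ → Bool} (h : Runs p v S v' S' t) (hc : c v' = false) :
    Runs (loop p c q) v S v' S' (t + 1) := fun Λ M ι k hM => by
  have := h Λ M (ι ∘ some ∘ Sum.inl) _ fun l => hM (some (Sum.inl l))
  simp only [TM2.stepAux, hc, cond_false] at this
  refine ReachesWithin.head ?_ this
  simp only [loop, TM2.stepAux, TM2.step]
  rw [hM none]
  rfl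

theorem Runs.loop_step {c : σ → Bool} (h : Runs p v S v' S' t) (hc : c v' = true)
    (hq : Runs q v' S' v'' S'' t') (hl : Runs (loop p c q) v'' S'' v₃ S₃ t'') :
    Runs (loop p c q) v S v₃ S₃ (t + t' + t'' + 1) := fun Λ M ι k hM => by
  have h1 := h Λ M (ι ∘ some ∘ Sum.inl) _ fun l => hM (some (Sum.inl l))
  have h2 := hq Λ M (ι ∘ some ∘ Sum.inr) _ fun l => hM (some (Sum.inr l))
  have h3 := hl Λ M ι k hM
  simp only [TM2.stepAux, hc, cond_true] at h1
  refine ReachesWithin.head ?_ ((h1.trans h2).trans h3)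
  simp only [loop, TM2.stepAux, TM2.step]
  rw [hM none]
  rfl

end rules

/-- The program that empties the stack `k` onto the stack `k'`, translating symbols on the way:
`f` stores a popped symbol in the internal state, `c` tells whether there was one, and `g` reads
it. -/
def move (k k' : K) (f : σ → Option (Γ k) → σ) (c : σ → Bool) (g : σ → Γ k') : Prog Γ σ :=
  loop (pop k f) c (push k' g)

theorem runs_move {k k' : K} (hk : k ≠ k') {f : σ → Option (Γ k) → σ} {c : σ → Bool}
    {g : σ → Γ k'} (φ : Γ k → Γ k') (hs : ∀ v a, c (f v (some a)) = true)
    (hn : ∀ v, c (f v none) = false) (hg : ∀ v a, g (f v (some a)) = φ a)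
    (hf : ∀ v a b, f (f v a) b = f v b) (v : σ) (S : ∀ k, List (Γ k)) :
    Runs (move k k' f c g) v S (f v none)
      (update (update S k []) k' (((S k).map φ).reverse ++ S k')) ((S k).length + 1) := by
  generalize hl : S k = l
  induction l generalizing v S with
  | nil =>
    have h := runs_pop (v := v) (S := S) k f
    rw [hl] at h
    exact (h.loop_exit (hn v)).cast rfl (by simp [hk.symm]) (by simp)
  | cons a l ih =>
    have h := runs_pop (v := v) (S := S) k f
    rw [hl] at h
    have h2 := ih (f v (some a)) (update (update S k l) k' (φ a :: S k')) (by
      rw [update_of_ne hk, update_self])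
    have h1 := runs_push (v := f v (some a)) (S := update S k l) k' g
    rw [hg, update_of_ne hk.symm] at h1
    refine (h.loop_step (hs v a) h1 h2).cast (hf _ _ _) ?_ ?_
    · funext j
      by_cases hj : j = k'
      · subst hj; simp
      · by_cases hj' : j = k
        · subst hj'; simp [hk]
        · simp [hj, hj']
    · simp

end Prog

/-! ### Machines from programs, and programs from machines -/

theorem initList_eq (tm : FinTM2) (s : List (tm.Γ tm.k₀)) :
    initList tm s = ⟨some tm.main, tm.initialState, update (fun _ => []) tm.k₀ s⟩ := by
  unfold initList
  congr 1
  funext k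
  by_cases h : k = tm.k₀
  · subst h; simp
  · simp [h]

theorem haltList_eq (tm : FinTM2) (s : List (tm.Γ tm.k₁)) :
    haltList tm s = ⟨none, tm.initialState, update (fun _ => []) tm.k₁ s⟩ := by
  unfold haltList
  congr 1
  funext k
  by_cases h : k = tm.k₁
  · subst h; simp
  · simp [h]

namespace Prog

variable {K : Type} {Γ : K → Type} {σ : Type}

/-- The machine that runs `p` and halts. -/
def toTM [DecidableEq K] [Fintype K] [Fintype σ] (p : Prog Γ σ) (k₀ k₁ : K) [Fintype (Γ k₀)]
    (v : σ) : FinTM2 where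
  K := K
  k₀ := k₀
  k₁ := k₁
  Γ := Γ
  Λ := Option p.Lbl
  main := none
  ΛFin := letI := p.fin; inferInstance
  σ := σ
  initialState := v
  m l := match l with
    | none => p.entry some TM2.Stmt.halt
    | some l => p.code some TM2.Stmt.halt l

theorem outputs_toTM [DecidableEq K] [Fintype K] [Fintype σ] {p : Prog Γ σ} {k₀ k₁ : K}
    [Fintype (Γ k₀)] {v : σ} {s : List (Γ k₀)} {s' : List (Γ k₁)} {t : ℕ}
    (h : Runs p v (update (fun _ => []) k₀ s) v (update (fun _ => []) k₁ s') t) :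
    Nonempty (TM2OutputsInTime (p.toTM k₀ k₁ v) s (some s') (t + 1)) := by
  obtain ⟨n, hn, e⟩ := ReachesWithin.head (f := TM2.step (p.toTM k₀ k₁ v).m)
    (a := ⟨some none, v, update (fun _ => []) k₀ s⟩) rfl
    (h (Option p.Lbl) (p.toTM k₀ k₁ v).m some TM2.Stmt.halt fun _ => rfl)
  refine ⟨⟨⟨n, ?_⟩, hn⟩⟩
  exact (congrArg (fun c => (flip bind (p.toTM k₀ k₁ v).step)^[n] (some c))
    (initList_eq (p.toTM k₀ k₁ v) s)).trans
      (e.trans (congrArg some (haltList_eq (p.toTM k₀ k₁ v) s').symm))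

/-- Polynomial-time computability from a program with polynomial running time. -/
theorem computable_toTM [DecidableEq K] [Fintype K] [Fintype σ] {p : Prog Γ σ} {k₀ k₁ : K}
    [Fintype (Γ k₀)] {v : σ} {α β A B : Type} {ea : α → List A} {eb : β → List B} {f : α → β}
    (i : Γ k₀ ≃ A) (o : Γ k₁ ≃ B) (time : Polynomial ℕ)
    (h : ∀ a, Runs p v (update (fun _ => []) k₀ ((ea a).map i.symm)) v
      (update (fun _ => []) k₁ ((eb (f a)).map o.symm)) (time.eval (ea a).length)) :
    Nonempty (TM2ComputableInPolyTime ea eb f) :=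
  ⟨{  tm := p.toTM k₀ k₁ v
      inputAlphabet := i
      outputAlphabet := o
      time := time + 1
      outputsFun := fun a => by
        rw [Polynomial.eval_add, Polynomial.eval_one]
        exact Classical.choice (outputs_toTM (h a)) }⟩

section lift

variable {K₁ : Type} {Γ₁ : K₁ → Type} {σ₁ Λ₁ Λ : Type}

/-- A statement of one machine as a statement of a larger one: `e` embeds its stacks, `γ` their
alphabets, `get` and `set` its internal states; the labels are renamed by `ι`, and halting is
replaced by going on with the statement `k`. -/
def liftStmt (e : K₁ → K) (γ : ∀ j, Γ₁ j ≃ Γ (e j)) (get : σ → σ₁) (set : σ₁ → σ → σ)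
    (ι : Λ₁ → Λ) (k : TM2.Stmt Γ Λ σ) : TM2.Stmt Γ₁ Λ₁ σ₁ → TM2.Stmt Γ Λ σ
  | .push j f q => .push (e j) (fun v => γ j (f (get v))) (liftStmt e γ get set ι k q)
  | .peek j f q => .peek (e j) (fun v x => set (f (get v) (x.map (γ j).symm)) v)
      (liftStmt e γ get set ι k q)
  | .pop j f q => .pop (e j) (fun v x => set (f (get v) (x.map (γ j).symm)) v)
      (liftStmt e γ get set ι k q)
  | .load f q => .load (fun v => set (f (get v)) v) (liftStmt e γ get set ι k q)
  | .branch c q q' => .branch (fun v => c (get v)) (liftStmt e γ get set ι k q)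
      (liftStmt e γ get set ι k q')
  | .goto l => .goto fun v => ι (l (get v))
  | .halt => k

/-- A machine as a program on a larger set of stacks and internal states. -/
def ofTM [Fintype Λ₁] (m : Λ₁ → TM2.Stmt Γ₁ Λ₁ σ₁) (main : Λ₁) (e : K₁ → K)
    (γ : ∀ j, Γ₁ j ≃ Γ (e j)) (get : σ → σ₁) (set : σ₁ → σ → σ) : Prog Γ σ where
  Lbl := Λ₁
  fin := inferInstance
  entry ι _ := .goto fun _ => ι main
  code ι k l := liftStmt e γ get set ι k (m l)

/-- The stacks `S` of the larger machine carry the stacks `T` of the embedded one, and agree with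
`S₀` elsewhere. -/
def Carries (e : K₁ → K) (γ : ∀ j, Γ₁ j ≃ Γ (e j)) (S₀ S : ∀ k, List (Γ k))
    (T : ∀ j, List (Γ₁ j)) : Prop :=
  (∀ j, S (e j) = (T j).map (γ j)) ∧ ∀ k, (∀ j, e j ≠ k) → S k = S₀ k

variable [DecidableEq K] [DecidableEq K₁] {e : K₁ → K} {γ : ∀ j, Γ₁ j ≃ Γ (e j)}
  {get : σ → σ₁} {set : σ₁ → σ → σ} {S₀ S : ∀ k, List (Γ k)} {T : ∀ j, List (Γ₁ j)}

theorem Carries.update (he : Injective e) (h : Carries e γ S₀ S T) (j : K₁) (l : List (Γ₁ j)) :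
    Carries e γ S₀ (update S (e j) (l.map (γ j))) (update T j l) := by
  refine ⟨fun i => ?_, fun k hk => ?_⟩
  · by_cases hi : i = j
    · subst hi; simp
    · rw [update_of_ne (he.ne hi), update_of_ne hi, h.1]
  · rw [update_of_ne (hk j).symm, h.2 k hk]

variable (hgs : ∀ x v, get (set x v) = x) (hss : ∀ x y v, set x (set y v) = set x v)
include hgs hss

theorem stepAux_liftStmt (he : Injective e) (ι : Λ₁ → Λ) (k : TM2.Stmt Γ Λ σ)
    (q : TM2.Stmt Γ₁ Λ₁ σ₁) (v₀ : σ) (x : σ₁) (h : Carries e γ S₀ S T) :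
    ∃ S', Carries e γ S₀ S' (TM2.stepAux q x T).stk ∧
      TM2.stepAux (liftStmt e γ get set ι k q) (set x v₀) S =
        match (TM2.stepAux q x T).l with
        | some l => ⟨some (ι l), set (TM2.stepAux q x T).var v₀, S'⟩
        | none => TM2.stepAux k (set (TM2.stepAux q x T).var v₀) S' := by
  have hd (j : K₁) : (S (e j)).head?.map (γ j).symm = (T j).head? := by
    rw [h.1 j, List.head?_map, Option.map_map]; simp
  induction q generalizing x S T with
  | push j f q ih =>
    have h' := h.update he j (f x :: T j)
    rw [List.map_cons, ← h.1 j] at h'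
    simp only [liftStmt, TM2.stepAux, hgs]
    exact ih _ h' fun i => by rw [h'.1 i, List.head?_map, Option.map_map]; simp
  | peek j f q ih =>
    simp only [liftStmt, TM2.stepAux, hgs, hss, hd]
    exact ih _ h hd
  | pop j f q ih =>
    have h' := h.update he j (T j).tail
    rw [List.map_tail, ← h.1 j] at h'
    simp only [liftStmt, TM2.stepAux, hgs, hss, hd]
    exact ih _ h' fun i => by rw [h'.1 i, List.head?_map, Option.map_map]; simp
  | load f q ih =>
    simp only [liftStmt, TM2.stepAux, hgs, hss]
    exact ih _ h hd
  | branch c q q' ih ih' =>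
    simp only [liftStmt, TM2.stepAux, hgs]
    cases c x
    · exact ih' _ h hd
    · exact ih _ h hd
  | goto l =>
    simp only [liftStmt, TM2.stepAux, hgs]
    exact ⟨S, h, rfl⟩
  | halt =>
    simp only [liftStmt, TM2.stepAux]
    exact ⟨S, h, rfl⟩

theorem reachesWithin_liftStmt (he : Injective e) (m : Λ₁ → TM2.Stmt Γ₁ Λ₁ σ₁)
    (M : Λ → TM2.Stmt Γ Λ σ) (ι : Λ₁ → Λ) (k : TM2.Stmt Γ Λ σ)
    (hM : ∀ l, M (ι l) = liftStmt e γ get set ι k (m l)) (v₀ : σ) {x' : σ₁}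
    {T' : ∀ j, List (Γ₁ j)} (n : ℕ) (l : Λ₁) (x : σ₁) (h : Carries e γ S₀ S T)
    (hr : (flip bind (TM2.step m))^[n] (some ⟨some l, x, T⟩) = some ⟨none, x', T'⟩) :
    ∃ S', Carries e γ S₀ S' T' ∧ ReachesWithin (TM2.step M) n ⟨some (ι l), set x v₀, S⟩
      (TM2.stepAux k (set x' v₀) S') := by
  induction n generalizing l x S T with
  | zero => simp at hr
  | succ n ih =>
    obtain ⟨S₁, h₁, e₁⟩ := stepAux_liftStmt hgs hss he ι k (m l) v₀ x h
    rw [iterate_succ_apply] at hr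
    change (flip bind (TM2.step m))^[n] (some (TM2.stepAux (m l) x T)) = _ at hr
    have hs : TM2.step M ⟨some (ι l), set x v₀, S⟩ =
        some (TM2.stepAux (liftStmt e γ get set ι k (m l)) (set x v₀) S) := by
      rw [TM2.step, hM]
    rcases hc : TM2.stepAux (m l) x T with ⟨_ | l₁, x₁, T₁⟩
    · rw [hc] at hr h₁ e₁
      cases n with
      | zero =>
        simp only [iterate_zero, id_eq, Option.some.injEq, TM2.Cfg.mk.injEq, true_and] at hr
        obtain ⟨rfl, rfl⟩ := hr
        exact ⟨S₁, h₁, .head (hs.trans (congrArg some e₁)) .refl⟩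
      | succ n =>
        exfalso
        rw [iterate_succ_apply] at hr
        change (flip bind (TM2.step m))^[n] none = _ at hr
        have : ∀ n, (flip bind (TM2.step m))^[n] none = none := fun n => by
          induction n with
          | zero => rfl
          | succ n ih => rw [iterate_succ_apply]; exact ih
        exact absurd ((this n).symm.trans hr) (by simp)
    · rw [hc] at hr h₁ e₁
      obtain ⟨S', h', r⟩ := ih l₁ x₁ h₁ hr
      exact ⟨S', h', .head (hs.trans (congrArg some e₁)) r⟩

theorem runs_ofTM [Fintype Λ₁] (he : Injective e) {m : Λ₁ → TM2.Stmt Γ₁ Λ₁ σ₁} {main : Λ₁}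
    (v₀ : σ) {x x' : σ₁} {T' : ∀ j, List (Γ₁ j)} {n t : ℕ} (ht : n ≤ t)
    (h : Carries e γ S₀ S T) {S' : ∀ k, List (Γ k)} (h' : Carries e γ S₀ S' T')
    (hr : (flip bind (TM2.step m))^[n] (some ⟨some main, x, T⟩) = some ⟨none, x', T'⟩) :
    Runs (ofTM m main e γ get set) (set x v₀) S (set x' v₀) S' t := fun Λ M ι k hM => by
  obtain ⟨S'', h'', r⟩ := reachesWithin_liftStmt hgs hss he m M ι k hM v₀ n main x h hr
  have : S'' = S' := by
    funext i
    by_cases hi : ∃ j, e j = i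
    · obtain ⟨j, rfl⟩ := hi
      rw [h''.1, h'.1]
    · push Not at hi
      rw [h''.2 i hi, h'.2 i hi]
  subst this
  exact r.mono ht

end lift

end Prog

/-! ### Composition of polynomial-time computable functions -/

section pushes

variable {K : Type} {Γ : K → Type} {Λ σ : Type}

/-- A bound for the number of symbols that a statement pushes. -/
def pushCount : TM2.Stmt Γ Λ σ → ℕ
  | .push _ _ q => pushCount q + 1
  | .peek _ _ q => pushCount q
  | .pop _ _ q => pushCount q
  | .load _ q => pushCount q
  | .branch _ q q' => pushCount q + pushCount q'
  | .goto _ => 0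
  | .halt => 0

variable [DecidableEq K]

theorem length_stepAux_le (q : TM2.Stmt Γ Λ σ) (v : σ) (S : ∀ k, List (Γ k)) (k : K) :
    ((TM2.stepAux q v S).stk k).length ≤ (S k).length + pushCount q := by
  induction q generalizing v S with
  | push j f q ih =>
    refine (ih _ _).trans ?_
    rw [pushCount]
    by_cases h : k = j
    · subst h; rw [update_self, List.length_cons]; omega
    · rw [update_of_ne h]; omega
  | peek j f q ih => exact ih _ _
  | pop j f q ih =>
    refine (ih _ _).trans ?_
    rw [pushCount]
    by_cases h : k = j
    · subst h; simp
    · simp [h]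
  | load f q ih => exact ih _ _
  | branch c q q' ih ih' =>
    rw [TM2.stepAux, pushCount]
    cases c v
    · exact (ih' _ _).trans (by omega)
    · exact (ih _ _).trans (by omega)
  | goto l => simp [pushCount]
  | halt => simp [pushCount]

theorem length_iterate_step_le [Fintype Λ] (m : Λ → TM2.Stmt Γ Λ σ) (k : K) (n : ℕ)
    (c c' : TM2.Cfg Γ Λ σ) (h : (flip bind (TM2.step m))^[n] (some c) = some c') :
    (c'.stk k).length ≤ (c.stk k).length + n * ∑ l, pushCount (m l) := by
  induction n generalizing c' with
  | zero => simp at h; simp [h]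
  | succ n ih =>
    rw [iterate_succ_apply'] at h
    rcases hd : (flip bind (TM2.step m))^[n] (some c) with _ | d
    · rw [hd] at h; cases h
    · have h₁ := ih d hd
      rw [hd] at h
      change TM2.step m d = some c' at h
      rcases d with ⟨_ | l, v, S⟩
      · cases h
      · have h₂ : TM2.stepAux (m l) v S = c' := Option.some.inj h
        have h₃ := length_stepAux_le (m l) v S k
        have h₄ : pushCount (m l) ≤ ∑ l, pushCount (m l) :=
          Finset.single_le_sum (f := fun l => pushCount (m l)) (fun _ _ => Nat.zero_le _)
            (Finset.mem_univ l)
        rw [h₂] at h₃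
        simp only at h₁
        rw [Nat.succ_mul]
        omega

end pushes

theorem Polynomial.eval_le_eval_nat (p : Polynomial ℕ) {a b : ℕ} (h : a ≤ b) :
    p.eval a ≤ p.eval b := by
  rw [Polynomial.eval_eq_sum, Polynomial.eval_eq_sum]
  exact Finset.sum_le_sum fun i _ => Nat.mul_le_mul_left _ (Nat.pow_le_pow_left h i)

namespace Prog

/-- Carrying the stacks that are all empty except for one. -/
theorem carries_single {K K₁ : Type} [DecidableEq K] [DecidableEq K₁] {Γ : K → Type}
    {Γ₁ : K₁ → Type} {e : K₁ → K} (he : Injective e) (γ : ∀ j, Γ₁ j ≃ Γ (e j)) (j : K₁)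
    (l : List (Γ₁ j)) :
    Carries e γ (fun _ => []) (Function.update (fun _ => []) (e j) (l.map (γ j)))
      (Function.update (fun _ => []) j l) :=
  Carries.update he ⟨fun _ => rfl, fun _ _ => rfl⟩ j l

/-- A program that moves the content of one stack to another one, keeping its order, when all
other stacks are empty.  If the common alphabet is empty, there is nothing to do, and no symbol to
write a program with. -/
theorem exists_transfer {K σ D : Type} [DecidableEq K] {Γ : K → Type} {k₁ k₂ k₃ : K}
    (h₁ : k₁ ≠ k₃) (h₂ : k₃ ≠ k₂) (i₁ : Γ k₁ ≃ D) (i₂ : Γ k₂ ≃ D) (i₃ : Γ k₃ ≃ D)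
    (get : σ → Option D) (set : Option D → σ → σ) (hgs : ∀ x v, get (set x v) = x)
    (hss : ∀ x y v, set x (set y v) = set x v) (hsg : ∀ v, set (get v) v = v) :
    ∃ p : Prog Γ σ, ∀ (v : σ) (l : List D), get v = none →
      Runs p v (update (fun _ => []) k₁ (l.map i₁.symm)) v
        (update (fun _ => []) k₂ (l.map i₂.symm)) (2 * l.length + 2) := by
  rcases isEmpty_or_nonempty D with hD | ⟨⟨d⟩⟩
  · refine ⟨skip, fun v l _ => runs_skip.cast rfl ?_ (Nat.zero_le _)⟩
    obtain rfl : l = [] := by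
      cases l with
      | nil => rfl
      | cons a l => exact hD.elim a
    funext k
    by_cases hk : k = k₁ <;> by_cases hk' : k = k₂ <;> simp
  · refine ⟨seq (move k₁ k₃ (fun v x => set (x.map i₁) v) (fun v => (get v).isSome)
        fun v => i₃.symm ((get v).getD d))
      (move k₃ k₂ (fun v x => set (x.map i₃) v) (fun v => (get v).isSome)
        fun v => i₂.symm ((get v).getD d)), fun v l hv => ?_⟩
    have m₁ := runs_move (σ := σ) h₁ (f := fun v x => set (x.map i₁) v)
      (c := fun v => (get v).isSome) (g := fun v => i₃.symm ((get v).getD d))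
      (fun a => i₃.symm (i₁ a)) (by simp [hgs]) (by simp [hgs]) (by simp [hgs]) (by simp [hss])
      v (update (fun _ => []) k₁ (l.map i₁.symm))
    have m₂ := runs_move (σ := σ) h₂ (f := fun v x => set (x.map i₃) v)
      (c := fun v => (get v).isSome) (g := fun v => i₂.symm ((get v).getD d))
      (fun a => i₂.symm (i₃ a)) (by simp [hgs]) (by simp [hgs]) (by simp [hgs]) (by simp [hss])
      v (update (fun _ => []) k₃ (l.reverse.map i₃.symm))
    have hv' : set none v = v := by rw [← hv, hsg]
    refine ((m₁.cast hv' ?_ le_rfl).seq m₂).cast hv' ?_ (by simp; omega)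
    · simp [h₁.symm, Function.comp_def, List.map_reverse]
    · simp [h₂.symm, Function.comp_def, List.map_reverse]

end Prog

open Prog in
/-- The composition of polynomial-time computable functions is polynomial-time computable: the
second machine runs after the first one, on stacks of its own, once the output of the first has
been moved to its input stack. -/
theorem TM2ComputableInPolyTime.comp {α β γ A B C : Type} {ea : α → List A} {eb : β → List B}
    {ec : γ → List C} {f : α → β} {g : β → γ} (h₁ : TM2ComputableInPolyTime ea eb f)
    (h₂ : TM2ComputableInPolyTime eb ec g) : Nonempty (TM2ComputableInPolyTime ea ec (g ∘ f)) := by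
  obtain ⟨⟨M₁, i₁, o₁⟩, T₁, h₁⟩ := h₁
  obtain ⟨⟨M₂, i₂, o₂⟩, T₂, h₂⟩ := h₂
  let _ : DecidableEq M₁.K := M₁.kDecidableEq
  let _ : DecidableEq M₂.K := M₂.kDecidableEq
  let _ : Fintype M₁.K := M₁.kFin
  let _ : Fintype M₂.K := M₂.kFin
  let _ : Fintype M₁.Λ := M₁.ΛFin
  let _ : Fintype M₂.Λ := M₂.ΛFin
  let _ : Fintype M₁.σ := M₁.σFin
  let _ : Fintype M₂.σ := M₂.σFin
  let _ : Fintype (M₂.Γ M₂.k₀) := M₂.Γk₀Fin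
  let _ : Fintype B := Fintype.ofEquiv _ i₂
  let K := M₁.K ⊕ (M₂.K ⊕ Unit)
  let Γ : K → Type := Sum.elim M₁.Γ (Sum.elim M₂.Γ fun _ => B)
  let σ := M₁.σ × M₂.σ × Option B
  let e₁ : M₁.K → K := Sum.inl
  let e₂ : M₂.K → K := Sum.inr ∘ Sum.inl
  let _ : Fintype (Γ (e₁ M₁.k₀)) := M₁.Γk₀Fin
  have he₁ : Injective e₁ := Sum.inl_injective
  have he₂ : Injective e₂ := Sum.inr_injective.comp Sum.inl_injective
  let γ₁ : ∀ j, M₁.Γ j ≃ Γ (e₁ j) := fun j => Equiv.refl (M₁.Γ j)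
  let γ₂ : ∀ j, M₂.Γ j ≃ Γ (e₂ j) := fun j => Equiv.refl (M₂.Γ j)
  let p₁ : Prog Γ σ := ofTM M₁.m M₁.main e₁ γ₁ (fun v => v.1) fun x v => (x, v.2)
  let p₂ : Prog Γ σ := ofTM M₂.m M₂.main e₂ γ₂ (fun v => v.2.1) fun x v => (v.1, x, v.2.2)
  obtain ⟨tr, htr⟩ := exists_transfer (Γ := Γ) (σ := σ) (k₁ := e₁ M₁.k₁) (k₂ := e₂ M₂.k₀)
    (k₃ := Sum.inr (Sum.inr ())) Sum.inl_ne_inr (Sum.inr_injective.ne Sum.inr_ne_inl) o₁ i₂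
    (Equiv.refl B) (fun v => v.2.2) (fun x v => (v.1, v.2.1, x))
    (fun _ _ => rfl) (fun _ _ _ => rfl) (fun _ => rfl)
  let c := ∑ l, pushCount (M₁.m l)
  let Q : Polynomial ℕ := Polynomial.X + T₁ * Polynomial.C c
  refine computable_toTM (p := seq p₁ (seq tr p₂)) (k₀ := e₁ M₁.k₀) (k₁ := e₂ M₂.k₁)
    (v := (M₁.initialState, M₂.initialState, none)) i₁ o₂
    (T₁ + (2 * Q + 2 + T₂.comp Q)) fun a => ?_
  obtain ⟨⟨n₁, r₁⟩, hn₁⟩ := h₁ a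
  obtain ⟨⟨n₂, r₂⟩, hn₂⟩ := h₂ (f a)
  rw [Option.map_some, haltList_eq, initList_eq] at r₁ r₂
  have hQ : (eb (f a)).length ≤ Q.eval (ea a).length := by
    have len := length_iterate_step_le M₁.m M₁.k₁ n₁ _ _ r₁
    simp only [update_self, List.length_map] at len
    have : (update (fun _ => []) M₁.k₀ ((ea a).map i₁.invFun) M₁.k₁).length ≤
        (ea a).length := by
      by_cases h : M₁.k₁ = M₁.k₀
      · rw [h]; simp
      · simp [h]
    simp only [Q, Polynomial.eval_add, Polynomial.eval_mul, Polynomial.eval_X, Polynomial.eval_C]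
    exact len.trans (add_le_add this (Nat.mul_le_mul_right _ hn₁))
  have R₁ := runs_ofTM (get := fun v : σ => v.1) (set := fun x v => (x, v.2)) (γ := γ₁)
    (fun _ _ => rfl) (fun _ _ _ => rfl) he₁ (M₁.initialState, M₂.initialState, none) hn₁
    (carries_single he₁ γ₁ _ _) (carries_single he₁ γ₁ _ _) r₁
  have R₂ := runs_ofTM (get := fun v : σ => v.2.1) (set := fun x v => (v.1, x, v.2.2)) (γ := γ₂)
    (fun _ _ => rfl) (fun _ _ _ => rfl) he₂ (M₁.initialState, M₂.initialState, none) hn₂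
    (carries_single he₂ γ₂ _ _) (carries_single he₂ γ₂ _ _) r₂
  have R := htr (M₁.initialState, M₂.initialState, none) (eb (f a)) rfl
  have hi₁ (j : M₁.K) (l : List (M₁.Γ j)) : l.map (γ₁ j) = l := List.map_id l
  have hi₂ (j : M₂.K) (l : List (M₂.Γ j)) : l.map (γ₂ j) = l := List.map_id l
  rw [hi₁, hi₁] at R₁
  rw [hi₂, hi₂] at R₂
  refine (R₁.seq (R.seq R₂)).mono ?_
  simp only [Polynomial.eval_add, Polynomial.eval_mul, Polynomial.eval_comp,
    Polynomial.eval_ofNat]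
  have := Polynomial.eval_le_eval_nat T₂ hQ
  omega

/-! ### Layouts of lists of pairs of natural numbers -/

/-- The edges of an instance as pairs of natural numbers. -/
def OrderedGraph.natEdges (I : OrderedGraph) : List (ℕ × ℕ) :=
  I.edges.map fun e => (e.1.val, e.2.val)

theorem OrderedGraph.lt_of_mem_natEdges (I : OrderedGraph) {e : ℕ × ℕ} (he : e ∈ I.natEdges) :
    e.1 < e.2 ∧ e.2 < I.n := by
  obtain ⟨e, h, rfl⟩ := List.mem_map.1 he
  exact ⟨I.lt_of_mem e h, e.2.2⟩

theorem OrderedGraph.nodup_natEdges (I : OrderedGraph) : I.natEdges.Nodup :=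
  I.nodup.map fun a b h => by
    simp only [Prod.mk.injEq] at h
    exact Prod.ext (Fin.ext h.1) (Fin.ext h.2)

/-- The unary string of a pair. -/
def encodePair (e : ℕ × ℕ) : List Bool := encodeUnary e.1 ++ encodeUnary e.2

theorem OrderedGraph.encode_eq (I : OrderedGraph) :
    I.encode = encodeUnary I.n ++ I.natEdges.flatMap encodePair := by
  simp [OrderedGraph.encode, OrderedGraph.natEdges, encodePair, List.flatMap_map]

/-- The instance with given edges. -/
def OrderedGraph.ofNatEdges (n : ℕ) (E : List (ℕ × ℕ)) (hE : ∀ e ∈ E, e.1 < e.2 ∧ e.2 < n)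
    (hd : E.Nodup) : OrderedGraph where
  n := n
  edges := E.pmap (fun e h => (⟨e.1, h.1.trans h.2⟩, ⟨e.2, h.2⟩)) hE
  lt_of_mem e he := by
    obtain ⟨e, h, rfl⟩ := List.mem_pmap.1 he
    exact (hE e h).1
  nodup := hd.pmap fun a _ b _ h => by
    simp only [Prod.mk.injEq, Fin.mk.injEq] at h
    exact Prod.ext h.1 h.2

@[simp]
theorem OrderedGraph.natEdges_ofNatEdges (n : ℕ) (E : List (ℕ × ℕ))
    (hE : ∀ e ∈ E, e.1 < e.2 ∧ e.2 < n) (hd : E.Nodup) :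
    (OrderedGraph.ofNatEdges n E hE hd).natEdges = E := by
  simp [OrderedGraph.natEdges, OrderedGraph.ofNatEdges, List.map_pmap]

/-- Two edges, in this order, are in conflict on a page of the given kind: they cross, if it is a
stack page, and the second is nested by the first, if it is a queue page. -/
def Conflict (stack : Prop) (e f : ℕ × ℕ) : Prop :=
  (stack ∧ e.1 < f.1 ∧ f.1 < e.2 ∧ e.2 < f.2) ∨ (¬ stack ∧ e.1 < f.1 ∧ f.2 < e.2)

/-- A page assignment as a single number: the stack pages are the numbers below `s`, the queue
pages the next `q` ones. -/
def IsPaging (s q : ℕ) (E : List (ℕ × ℕ)) (page : ℕ × ℕ → ℕ) : Prop :=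
  (∀ e ∈ E, page e < s + q) ∧
    ∀ e ∈ E, ∀ f ∈ E, page e = page f → ¬ Conflict (page e < s) e f

theorem OrderedGraph.mk_mem_edgeSet (I : OrderedGraph) {u v : Fin I.n} (h : u < v) :
    s(u, v) ∈ I.graph.edgeSet ↔ (u, v) ∈ I.edges := by
  simp only [OrderedGraph.graph, SimpleGraph.mem_edgeSet, SimpleGraph.fromRel_adj]
  constructor
  · rintro ⟨-, h' | h'⟩
    · exact h'
    · exact absurd (I.lt_of_mem _ h') h.asymm
  · exact fun h' => ⟨h.ne, Or.inl h'⟩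

theorem OrderedGraph.mem_natEdges (I : OrderedGraph) {u v : Fin I.n} :
    (u.val, v.val) ∈ I.natEdges ↔ (u, v) ∈ I.edges := by
  simp only [OrderedGraph.natEdges, List.mem_map, Prod.mk.injEq, Prod.exists]
  constructor
  · rintro ⟨a, b, h, ha, hb⟩
    rwa [← Fin.ext ha, ← Fin.ext hb]
  · exact fun h => ⟨u, v, h, rfl, rfl⟩

theorem fixedOrderMixedLayout_iff (s q : ℕ) (I : OrderedGraph) :
    FixedOrderMixedLayout s q I ↔ ∃ page, IsPaging s q I.natEdges page := by
  constructor
  · rintro ⟨page, hs, hq⟩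
    let num : Fin s ⊕ Fin q → ℕ := Sum.elim (fun i => i.val) fun j => s + j.val
    have key : ∀ e : ℕ × ℕ, ∃ k, e ∈ I.natEdges → ∃ (e' : I.graph.edgeSet) (u v : Fin I.n),
        e'.1 = s(u, v) ∧ u < v ∧ e = (u.val, v.val) ∧ k = num (page e') := by
      intro e
      by_cases he : e ∈ I.natEdges
      · obtain ⟨⟨u, v⟩, h, rfl⟩ := List.mem_map.1 he
        have huv := I.lt_of_mem _ h
        exact ⟨_, fun _ => ⟨⟨s(u, v), (I.mk_mem_edgeSet huv).2 h⟩, u, v, rfl, huv, rfl, rfl⟩⟩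
      · exact ⟨0, fun h => absurd h he⟩
    choose nat hnat using key
    refine ⟨nat, fun e he => ?_, fun e he f hf hef => ?_⟩
    · obtain ⟨e', u, v, -, -, -, hk⟩ := hnat e he
      rw [hk]
      cases page e' with
      | inl i => have := i.2; simp only [num, Sum.elim_inl]; omega
      | inr j => have := j.2; simp only [num, Sum.elim_inr]; omega
    · obtain ⟨e', u, v, he', huv, rfl, hk⟩ := hnat e he
      obtain ⟨f', w, x, hf', hwx, rfl, hk'⟩ := hnat f hf
      have hp : page e' = page f' := by
        rw [hk, hk'] at hef
        cases h : page e' with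
        | inl i =>
          cases h' : page f' with
          | inl i' =>
            simp only [num, h, h', Sum.elim_inl] at hef
            rw [Fin.ext hef]
          | inr j' =>
            have := i.2
            simp only [num, h, h', Sum.elim_inl, Sum.elim_inr] at hef
            omega
        | inr j =>
          cases h' : page f' with
          | inl i' =>
            have := i'.2
            simp only [num, h, h', Sum.elim_inl, Sum.elim_inr] at hef
            omega
          | inr j' =>
            simp only [num, h, h', Sum.elim_inr] at hef
            rw [Fin.ext (Nat.add_left_cancel hef)]
      rw [hk]
      rintro (⟨hst, h₁, h₂, h₃⟩ | ⟨hst, h₁, h₂⟩)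
      · cases h : page e' with
        | inl i => exact hs i e' f' h (hp ▸ h) ⟨u, v, w, x, he', hf', h₁, h₂, h₃⟩
        | inr j => simp [num, h] at hst
      · cases h : page e' with
        | inl i => simp [num, h] at hst
        | inr j => exact hq j e' f' h (hp ▸ h) ⟨u, v, w, x, he', hf', h₁, hwx, h₂⟩
  · rintro ⟨page, hlt, hc⟩
    let key : Sym2 (Fin I.n) → ℕ × ℕ := fun e => (e.inf.val, e.sup.val)
    have key_mk {u v : Fin I.n} (h : u < v) : key s(u, v) = (u.val, v.val) := by
      simp [key, min_eq_left h.le, max_eq_right h.le]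
    have key_mem (e : I.graph.edgeSet) : key e.1 ∈ I.natEdges := by
      obtain ⟨e, he⟩ := e
      induction e using Sym2.ind with
      | _ u v =>
        rcases lt_or_gt_of_ne (I.graph.ne_of_adj he) with h | h
        · rw [key_mk h, I.mem_natEdges]
          exact (I.mk_mem_edgeSet h).1 he
        · have he' : s(v, u) ∈ I.graph.edgeSet := Sym2.eq_swap ▸ he
          change key s(u, v) ∈ _
          rw [Sym2.eq_swap, key_mk h, I.mem_natEdges]
          exact (I.mk_mem_edgeSet h).1 he'
    refine ⟨fun e => if h : page (key e.1) < s then Sum.inl ⟨_, h⟩ else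
      Sum.inr ⟨page (key e.1) - s, by have := hlt _ (key_mem e); omega⟩,
      fun i e f he hf => ?_, fun j e f he hf => ?_⟩
    · dsimp only at he hf
      split_ifs at he hf with h₁ h₂
      simp only [Sum.inl.injEq] at he hf
      have hp : page (key e.1) = page (key f.1) := congrArg Fin.val (he.trans hf.symm)
      rintro ⟨u, v, w, x, heq, hfq, h₁', h₂', h₃'⟩
      have := hc _ (key_mem e) _ (key_mem f) hp
      rw [heq] at h₁
      rw [heq, hfq, key_mk (h₁'.trans h₂'), key_mk (h₂'.trans h₃')] at this
      rw [key_mk (h₁'.trans h₂')] at h₁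
      exact this (Or.inl ⟨h₁, h₁', h₂', h₃'⟩)
    · dsimp only at he hf
      split_ifs at he hf with h₁ h₂
      simp only [Sum.inr.injEq] at he hf
      have hp : page (key e.1) = page (key f.1) := by
        have := congrArg Fin.val (he.trans hf.symm)
        simp only at this
        omega
      rintro ⟨u, v, w, x, heq, hfq, h₁', h₂', h₃'⟩
      have := hc _ (key_mem e) _ (key_mem f) hp
      rw [heq] at h₁
      rw [heq, hfq, key_mk (h₁'.trans (h₂'.trans h₃')), key_mk h₂'] at this
      rw [key_mk (h₁'.trans (h₂'.trans h₃'))] at h₁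
      exact this (Or.inr ⟨h₁, h₁', h₃'⟩)

/-! ### Adding a page -/

/-- If the image of `E` under a strictly monotone change of the vertices avoids the page `p` of a
layout with one page more, then `p` can be dropped: the pages above it move down by one. -/
theorem IsPaging.drop {s q s' q' p : ℕ} {E E' : List (ℕ × ℕ)} {page : ℕ × ℕ → ℕ} {φ : ℕ → ℕ}
    (h : IsPaging s' q' E' page) (hφ : StrictMono φ) (hE : ∀ e ∈ E, Prod.map φ φ e ∈ E')
    (hp : p < s' ∧ s' = s + 1 ∧ q' = q ∨ s' ≤ p ∧ p < s' + q' ∧ s' = s ∧ q' = q + 1)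
    (hne : ∀ e ∈ E, page (Prod.map φ φ e) ≠ p) : ∃ page', IsPaging s q E page' := by
  refine ⟨fun e => if p < page (Prod.map φ φ e) then page (Prod.map φ φ e) - 1 else
    page (Prod.map φ φ e), fun e he => ?_, fun e he f hf hef => ?_⟩
  · have h₁ := h.1 _ (hE e he)
    have h₂ := hne e he
    dsimp only
    split_ifs <;> omega
  · have h₁ := hne e he
    have h₂ := hne f hf
    have h₃ := h.2 _ (hE e he) _ (hE f hf)
    have h₄ : page (Prod.map φ φ e) = page (Prod.map φ φ f) := by
      dsimp only at hef
      split_ifs at hef <;> omega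
    have h₅ : page (Prod.map φ φ e) < s' ↔
        (if p < page (Prod.map φ φ e) then page (Prod.map φ φ e) - 1 else
          page (Prod.map φ φ e)) < s := by
      split_ifs <;> omega
    have h₆ := h₃ h₄
    rw [Conflict, h₅] at h₆
    simpa only [Conflict, Prod.map_fst, Prod.map_snd, hφ.lt_iff_lt] using h₆

/-- Extending a layout of `E` to more edges `L`, with one page more.  The new page gets the number
`s`, whether it is a stack page or a queue page. -/
theorem IsPaging.extend {s q s' q' : ℕ} {E L : List (ℕ × ℕ)} {page pageL : ℕ × ℕ → ℕ} {φ : ℕ → ℕ}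
    (h : IsPaging s q E page) (hφ : StrictMono φ)
    (hs : s' = s + 1 ∧ q' = q ∨ s' = s ∧ q' = q + 1) (hL : IsPaging s' q' L pageL)
    (hle : ∀ f ∈ L, pageL f ≤ s)
    (hd : ∀ e ∈ E, ∀ f ∈ L, pageL f < s →
      ¬ Conflict True (Prod.map φ φ e) f ∧ ¬ Conflict True f (Prod.map φ φ e))
    (hdisj : ∀ e ∈ E, Prod.map φ φ e ∉ L) :
    ∃ page', IsPaging s' q' (L ++ E.map (Prod.map φ φ)) page' := by
  classical
  have hinj : Function.Injective (Prod.map φ φ) := hφ.injective.prodMap hφ.injective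
  let bump : ℕ → ℕ := fun k => if k < s then k else k + 1
  let page' : ℕ × ℕ → ℕ := fun e => if e ∈ L then pageL e else
    bump (page (Function.invFun (Prod.map φ φ) e))
  have hpL : ∀ f ∈ L, page' f = pageL f := fun f hf => if_pos hf
  have hpE : ∀ e ∈ E, page' (Prod.map φ φ e) = bump (page e) := fun e he => by
    simp only [page', if_neg (hdisj e he), Function.leftInverse_invFun hinj e]
  refine ⟨page', fun e he => ?_, fun e he f hf hef => ?_⟩
  · rcases List.mem_append.1 he with he | he
    · rw [hpL e he]; exact hL.1 e he
    · obtain ⟨e₀, he₀, rfl⟩ := List.mem_map.1 he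
      rw [hpE e₀ he₀]
      have := h.1 e₀ he₀
      simp only [bump]
      split_ifs <;> omega
  · rcases List.mem_append.1 he with he | he <;> rcases List.mem_append.1 hf with hf | hf
    · rw [hpL e he, hpL f hf] at *
      exact hL.2 e he f hf hef
    · obtain ⟨f₀, hf₀, rfl⟩ := List.mem_map.1 hf
      rw [hpL e he, hpE f₀ hf₀] at hef
      have h₁ := hle e he
      have h₂ : pageL e < s := by
        simp only [bump] at hef
        split_ifs at hef <;> omega
      have h₃ := (hd f₀ hf₀ e he h₂).2
      rw [hpL e he]
      simpa [Conflict, show pageL e < s' by omega] using h₃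
    · obtain ⟨e₀, he₀, rfl⟩ := List.mem_map.1 he
      rw [hpL f hf, hpE e₀ he₀] at hef
      have h₁ := hle f hf
      have h₂ : pageL f < s := by
        simp only [bump] at hef
        split_ifs at hef <;> omega
      have h₃ := (hd e₀ he₀ f hf h₂).1
      rw [hpE e₀ he₀, hef]
      simpa [Conflict, show pageL f < s' by omega] using h₃
    · obtain ⟨e₀, he₀, rfl⟩ := List.mem_map.1 he
      obtain ⟨f₀, hf₀, rfl⟩ := List.mem_map.1 hf
      rw [hpE e₀ he₀, hpE f₀ hf₀] at hef
      have h₁ : page e₀ = page f₀ := by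
        simp only [bump] at hef
        split_ifs at hef <;> omega
      have h₂ : bump (page e₀) < s' ↔ page e₀ < s := by
        simp only [bump]
        split_ifs <;> omega
      have h₃ := h.2 e₀ he₀ f₀ hf₀ h₁
      rw [hpE e₀ he₀, Conflict, h₂]
      simpa only [Conflict, Prod.map_fst, Prod.map_snd, hφ.lt_iff_lt] using h₃

/-! ### The gadget for a queue page -/

/-- `t` pairwise crossing edges around an interval of `n` vertices. -/
def twist (t n : ℕ) : List (ℕ × ℕ) :=
  (List.range t).map fun i => (i, n + (t + i))

theorem mem_twist {t n : ℕ} {e : ℕ × ℕ} : e ∈ twist t n ↔ e.1 < t ∧ e.2 = n + (t + e.1) := by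
  simp only [twist, List.mem_map, List.mem_range]
  constructor
  · rintro ⟨i, hi, rfl⟩; exact ⟨hi, rfl⟩
  · rintro ⟨h, h'⟩; exact ⟨e.1, h, Prod.ext rfl h'.symm⟩

theorem nodup_twist (t n : ℕ) : (twist t n).Nodup :=
  List.nodup_range.map fun a b h => by simp only [Prod.mk.injEq] at h; exact h.1

/-- A twist with one edge more than there are stack pages has an edge on a queue page, and no edge
inside the twist can be on that page; conversely the twist fits on a single queue page. -/
theorem exists_isPaging_twist (s q n : ℕ) {E : List (ℕ × ℕ)} (hE : ∀ e ∈ E, e.1 < e.2 ∧ e.2 < n) :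
    (∃ page, IsPaging s q E page) ↔ ∃ page, IsPaging s (q + 1) (twist (s + 1) n ++
      E.map (Prod.map (fun a => 1 * a + (s + 1)) fun a => 1 * a + (s + 1))) page := by
  have hφ : StrictMono fun a : ℕ => 1 * a + (s + 1) := fun a b h => by dsimp only; omega
  constructor
  · rintro ⟨page, h⟩
    refine h.extend hφ (Or.inr ⟨rfl, rfl⟩) (pageL := fun _ => s)
      ⟨fun _ _ => by dsimp only; omega, ?_⟩ (fun _ _ => le_rfl)
      (fun _ _ _ _ h => absurd h (lt_irrefl _)) ?_
    · intro e he f hf _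
      rw [mem_twist] at he hf
      simp only [Conflict]
      omega
    · intro e _ h
      rw [mem_twist, Prod.map_fst] at h
      omega
  · rintro ⟨page, h⟩
    have hmem (i : ℕ) (hi : i < s + 1) : (i, n + (s + 1 + i)) ∈ twist (s + 1) n ++
        E.map (Prod.map (fun a => 1 * a + (s + 1)) fun a => 1 * a + (s + 1)) :=
      List.mem_append_left _ (mem_twist.2 ⟨hi, rfl⟩)
    obtain ⟨i, hi, hp⟩ : ∃ i < s + 1, s ≤ page (i, n + (s + 1 + i)) := by
      by_contra! hlt
      obtain ⟨i, hi, j, hj, hij, heq⟩ := Finset.exists_ne_map_eq_of_card_lt_of_maps_to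
        (s := Finset.range (s + 1)) (t := Finset.range s) (f := fun i => page (i, n + (s + 1 + i)))
        (by simp) (fun i hi => by simpa using hlt i (by simpa using hi))
      wlog hlt' : i < j generalizing i j
      · exact this j hj i hi hij.symm heq.symm (by omega)
      rw [Finset.mem_range] at hi hj
      exact h.2 _ (hmem i hi) _ (hmem j hj) heq
        (Or.inl ⟨hlt i hi, by dsimp only; omega⟩)
    have hmemE (e : ℕ × ℕ) (he : e ∈ E) := List.mem_append_right (twist (s + 1) n)
      (List.mem_map_of_mem (f := Prod.map (fun a => 1 * a + (s + 1)) fun a => 1 * a + (s + 1)) he)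
    refine h.drop hφ hmemE (Or.inr ⟨hp, h.1 _ (hmem i hi), rfl, rfl⟩) fun e he heq => ?_
    refine h.2 _ (hmem i hi) _ (hmemE e he) heq.symm (Or.inr ⟨by omega, ?_⟩)
    have := hE e he
    simp only [Prod.map_fst, Prod.map_snd]
    omega

/-! ### The gadget for a stack page -/

/-- The `x` pairwise nested edges that join the positions before `x` to the `x` positions from `y`
on, innermost edge first. -/
def rainbow : ℕ → ℕ → List (ℕ × ℕ)
  | 0, _ => []
  | x + 1, y => (x, y) :: rainbow x (y + 1)

theorem mem_rainbow {x y : ℕ} {e : ℕ × ℕ} :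
    e ∈ rainbow x y ↔ e.1 < x ∧ e.1 + e.2 + 1 = x + y := by
  induction x generalizing y with
  | zero => simp [rainbow]
  | succ x ih =>
    rw [rainbow, List.mem_cons, ih, Prod.ext_iff]
    dsimp only
    omega

theorem nodup_rainbow (x y : ℕ) : (rainbow x y).Nodup := by
  induction x generalizing y with
  | zero => simp [rainbow]
  | succ x ih =>
    rw [rainbow, List.nodup_cons, mem_rainbow]
    exact ⟨by dsimp only; omega, ih _⟩

/-- `s` pairwise crossing rainbows of `q + 1` edges each, from the positions from `x` on to those
from `x + y` on. -/
def rainbows (s q x y : ℕ) : List (ℕ × ℕ) :=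
  (List.range s).flatMap fun b => (List.range (q + 1)).map fun j =>
    (x + (b * (q + 1) + j), x + y + (b * (q + 1) + (q - j)))

theorem mem_rainbows {s q x y : ℕ} {e : ℕ × ℕ} :
    e ∈ rainbows s q x y ↔ ∃ b < s, ∃ j ≤ q,
      e = (x + (b * (q + 1) + j), x + y + (b * (q + 1) + (q - j))) := by
  simp only [rainbows, List.mem_flatMap, List.mem_map, List.mem_range, Nat.lt_succ_iff, eq_comm]

theorem block_lt {b b' j j' q : ℕ} (h : b < b') (hj : j ≤ q) :
    b * (q + 1) + j < b' * (q + 1) + j' := by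
  have : (b + 1) * (q + 1) ≤ b' * (q + 1) := Nat.mul_le_mul_right _ h
  rw [Nat.add_mul] at this
  omega

theorem nodup_rainbows (s q x y : ℕ) : (rainbows s q x y).Nodup := by
  refine List.nodup_flatMap.2 ⟨fun b _ => List.nodup_range.map fun i j h => ?_, ?_⟩
  · simp only [Prod.mk.injEq] at h; omega
  · refine List.nodup_range.imp_of_mem ?_
    intro b b' _ _ hne e he he'
    simp only [List.mem_map, List.mem_range] at he he'
    obtain ⟨j, hj, rfl⟩ := he
    obtain ⟨j', hj', h⟩ := he'
    simp only [Prod.mk.injEq] at h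
    rcases lt_or_gt_of_ne hne with hlt | hlt
    · have := block_lt (j' := j') hlt (Nat.lt_succ_iff.1 hj); omega
    · have := block_lt (j' := j) hlt (Nat.lt_succ_iff.1 hj'); omega

/-- Among `q + 1` pairwise nested edges there is one on a stack page, as no two of them are on the
same queue page. -/
theorem IsPaging.exists_stack {s q : ℕ} {E : List (ℕ × ℕ)} {page : ℕ × ℕ → ℕ}
    (h : IsPaging s q E page) (g : ℕ → ℕ × ℕ) (hg : ∀ j ≤ q, g j ∈ E)
    (hn : ∀ i j, i < j → j ≤ q → (g i).1 < (g j).1 ∧ (g j).2 < (g i).2) :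
    ∃ j ≤ q, page (g j) < s := by
  by_contra! hge
  obtain ⟨i, hi, j, hj, hij, heq⟩ := Finset.exists_ne_map_eq_of_card_lt_of_maps_to
    (s := Finset.range (q + 1)) (t := Finset.Ico s (s + q)) (f := fun i => page (g i))
    (by simp) (fun i hi => by
      have hi' : i ≤ q := by simpa [Nat.lt_succ_iff] using hi
      simpa using ⟨hge i hi', h.1 _ (hg i hi')⟩)
  wlog hlt : i < j generalizing i j
  · exact this j hj i hi hij.symm heq.symm (by omega)
  have hi' : i ≤ q := by simpa [Nat.lt_succ_iff] using hi
  have hj' : j ≤ q := by simpa [Nat.lt_succ_iff] using hj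
  exact h.2 _ (hg i hi') _ (hg j hj') heq (Or.inr ⟨not_lt.2 (hge i hi'), hn i j hlt hj'⟩)

/-- Each of the `s` crossing rainbows has an edge on a stack page; these stack pages are different,
so all edges of the long rainbow that are on stack pages are on the remaining one, `p` say.  Every
edge of `E` is crossed by `q + 1` edges of the long rainbow, one of which is on `p`.  Conversely
the long rainbow fits on one stack page, and the other rainbows do so on the old stack pages. -/
theorem exists_isPaging_rainbows (s q n : ℕ) {E : List (ℕ × ℕ)}
    (hE : ∀ e ∈ E, e.1 < e.2 ∧ e.2 < n) :
    (∃ page, IsPaging s q E page) ↔ ∃ page, IsPaging (s + 1) q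
      ((rainbows s q ((q + 2) * n) ((q + 2) * n + s * (q + 1)) ++
        rainbow ((q + 2) * n) ((q + 2) * n + s * (q + 1))) ++
      E.map (Prod.map (fun a => (q + 2) * a + 0) fun a => (q + 2) * a + 0)) page := by
  have hφ : StrictMono fun a : ℕ => (q + 2) * a + 0 := fun a b h =>
    Nat.add_lt_add_right (Nat.mul_lt_mul_of_pos_left h (by omega)) 0
  have hmul {a b : ℕ} (h : a < b) : (q + 2) * a + (q + 2) ≤ (q + 2) * b := by
    have : (q + 2) * (a + 1) ≤ (q + 2) * b := Nat.mul_le_mul_left _ h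
    rwa [Nat.mul_add, Nat.mul_one] at this
  have hblock {b : ℕ} (hb : b < s) : b * (q + 1) + (q + 1) ≤ s * (q + 1) := by
    have : (b + 1) * (q + 1) ≤ s * (q + 1) := Nat.mul_le_mul_right _ hb
    rwa [Nat.add_mul, Nat.one_mul] at this
  generalize hx : (q + 2) * n = x at *
  generalize hh : s * (q + 1) = h₀ at *
  constructor
  · rintro ⟨page, h⟩
    have hlt (e : ℕ × ℕ) (he : e ∈ E) : (q + 2) * e.1 < x ∧ (q + 2) * e.2 < x := by
      have h₁ := hmul (hE e he).1
      have h₂ := hmul (hE e he).2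
      omega
    -- The edge with left end `x + (b * (q + 1) + j)` is on page `b`, the long rainbow on the new
    -- page `s`.
    let pageL : ℕ × ℕ → ℕ := fun f => if f.1 < x then s else (f.1 - x) / (q + 1)
    have hW {f : ℕ × ℕ} (hf : f ∈ rainbow x (x + h₀)) : pageL f = s :=
      if_pos (mem_rainbow.1 hf).1
    have hX (b j : ℕ) (hj : j ≤ q) : pageL (x + (b * (q + 1) + j),
        x + (x + h₀) + (b * (q + 1) + (q - j))) = b := by
      simp only [pageL]
      rw [if_neg (by omega), Nat.add_sub_cancel_left, Nat.add_comm, Nat.add_mul_div_right _ _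
        (by omega), Nat.div_eq_of_lt (by omega), Nat.zero_add]
    have hle (f : ℕ × ℕ) (hf : f ∈ rainbows s q x (x + h₀) ++ rainbow x (x + h₀)) :
        pageL f ≤ s := by
      rcases List.mem_append.1 hf with hf | hf
      · obtain ⟨b, hb, j, hj, rfl⟩ := mem_rainbows.1 hf
        rw [hX b j hj]; omega
      · rw [hW hf]
    refine h.extend hφ (Or.inl ⟨rfl, rfl⟩) (pageL := pageL)
      ⟨fun f hf => by have := hle f hf; omega, ?_⟩ hle ?_ ?_
    · intro e he f hf hef
      have h₁ := hle e he
      simp only [Conflict, show pageL e < s + 1 by omega, true_and, not_true_eq_false, false_and,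
        or_false]
      rcases List.mem_append.1 he with he | he <;> rcases List.mem_append.1 hf with hf | hf
      · obtain ⟨b, hb, i, hi, rfl⟩ := mem_rainbows.1 he
        obtain ⟨c, hc, j, hj, rfl⟩ := mem_rainbows.1 hf
        rw [hX b i hi, hX c j hj] at hef
        subst hef
        dsimp only
        omega
      · obtain ⟨b, hb, i, hi, rfl⟩ := mem_rainbows.1 he
        rw [hX b i hi, hW hf] at hef
        omega
      · obtain ⟨c, hc, j, hj, rfl⟩ := mem_rainbows.1 hf
        rw [hW he, hX c j hj] at hef
        omega
      · rw [mem_rainbow] at he hf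
        omega
    · intro e he f hf hlt'
      have h₁ := hlt e he
      rcases List.mem_append.1 hf with hf | hf
      · obtain ⟨b, hb, j, hj, rfl⟩ := mem_rainbows.1 hf
        simp only [Conflict, Prod.map_fst, Prod.map_snd]
        omega
      · rw [hW hf] at hlt'
        exact absurd hlt' (lt_irrefl _)
    · intro e he hm
      have h₁ := hlt e he
      rcases List.mem_append.1 hm with hf | hf
      · obtain ⟨b, hb, j, hj, hf⟩ := mem_rainbows.1 hf
        simp only [Prod.map_apply', Prod.mk.injEq] at hf
        omega
      · rw [mem_rainbow, Prod.map_fst, Prod.map_snd] at hf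
        omega
  · rintro ⟨page, h⟩
    have hX (b j : ℕ) (hb : b < s) (hj : j ≤ q) :=
      List.mem_append_left (E.map (Prod.map (fun a => (q + 2) * a + 0) fun a => (q + 2) * a + 0))
        (List.mem_append_left (rainbow x (x + h₀))
          (mem_rainbows.2 ⟨b, hb, j, hj, rfl⟩ :
            (x + (b * (q + 1) + j), x + (x + h₀) + (b * (q + 1) + (q - j))) ∈
              rainbows s q x (x + h₀)))
    have hW (i : ℕ) (hi : i < x) :=
      List.mem_append_left (E.map (Prod.map (fun a => (q + 2) * a + 0) fun a => (q + 2) * a + 0))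
        (List.mem_append_right (rainbows s q x (x + h₀))
          (mem_rainbow.2 ⟨hi, by dsimp only; omega⟩ :
            (i, x + (x + h₀) - 1 - i) ∈ rainbow x (x + h₀)))
    have hmemE (e : ℕ × ℕ) (he : e ∈ E) :=
      List.mem_append_right (rainbows s q x (x + h₀) ++ rainbow x (x + h₀))
      (List.mem_map_of_mem (f := Prod.map (fun a => (q + 2) * a + 0) fun a => (q + 2) * a + 0) he)
    have key (b : ℕ) : ∃ f : ℕ × ℕ, b < s → page f < s + 1 ∧ ∃ j ≤ q,
        f = (x + (b * (q + 1) + j), x + (x + h₀) + (b * (q + 1) + (q - j))) := by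
      by_cases hb : b < s
      · obtain ⟨j, hj, hp⟩ := h.exists_stack (fun j => (x + (b * (q + 1) + j),
          x + (x + h₀) + (b * (q + 1) + (q - j)))) (fun j hj => hX b j hb hj)
          (fun i j hij hj => by dsimp only; omega)
        exact ⟨_, fun _ => ⟨hp, j, hj, rfl⟩⟩
      · exact ⟨(0, 0), fun h => absurd h hb⟩
    choose f hf using key
    have hfmem (b : ℕ) (hb : b < s) : f b ∈ (rainbows s q x (x + h₀) ++ rainbow x (x + h₀)) ++
        E.map (Prod.map (fun a => (q + 2) * a + 0) fun a => (q + 2) * a + 0) := by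
      obtain ⟨-, j, hj, hfj⟩ := hf b hb
      exact hfj ▸ hX b j hb hj
    have hinj : Set.InjOn (fun b => page (f b)) (Finset.range s : Set ℕ) := by
      intro b hb c hc hbc
      by_contra hne
      wlog hlt : b < c generalizing b c
      · exact this hc hb hbc.symm (Ne.symm hne) (by omega)
      have hb : b < s := by simpa using hb
      have hc : c < s := by simpa using hc
      refine h.2 _ (hfmem b hb) _ (hfmem c hc) hbc (Or.inl ⟨(hf b hb).1, ?_⟩)
      obtain ⟨-, i, hi, hfi⟩ := hf b hb
      obtain ⟨-, j, hj, hfj⟩ := hf c hc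
      have h₁ := block_lt (j' := j) hlt hi
      have h₂ := block_lt (j' := q - j) hlt (Nat.sub_le q i)
      have h₃ := hblock hc
      rw [hfi, hfj]
      dsimp only
      omega
    -- The stack page that the short rainbows leave over.
    obtain ⟨p, hp⟩ : ∃ p, (Finset.range (s + 1)) \ ((Finset.range s).image fun b => page (f b)) =
        {p} := by
      rw [← Finset.card_eq_one, Finset.card_sdiff_of_subset, Finset.card_image_of_injOn hinj]
      · simp
      · intro k hk
        obtain ⟨b, hb, rfl⟩ := Finset.mem_image.1 hk
        exact Finset.mem_range.2 (hf b (Finset.mem_range.1 hb)).1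
    have hps : p < s + 1 := by
      have : p ∈ ({p} : Finset ℕ) := Finset.mem_singleton_self p
      rw [← hp] at this
      exact Finset.mem_range.1 (Finset.mem_sdiff.1 this).1
    have hWp (i : ℕ) (hi : i < x) (hs : page (i, x + (x + h₀) - 1 - i) < s + 1) :
        page (i, x + (x + h₀) - 1 - i) = p := by
      rw [← Finset.mem_singleton, ← hp, Finset.mem_sdiff, Finset.mem_range, Finset.mem_image]
      refine ⟨hs, ?_⟩
      rintro ⟨b, hb, hbi⟩
      rw [Finset.mem_range] at hb
      refine h.2 _ (hW i hi) _ (hfmem b hb) hbi.symm (Or.inl ⟨hs, ?_⟩)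
      obtain ⟨-, j, hj, hfj⟩ := hf b hb
      have h₃ := hblock hb
      rw [hfj]
      dsimp only
      omega
    refine h.drop hφ hmemE (Or.inl ⟨hps, rfl, rfl⟩) fun e he heq => ?_
    have h₁ := hmul (hE e he).1
    have h₂ := hmul (hE e he).2
    -- The edges of the long rainbow at the `q + 1` new vertices after the left end of `e`.
    obtain ⟨j, hj, hpj⟩ := h.exists_stack
      (fun j => ((q + 2) * e.1 + 1 + j, x + (x + h₀) - 1 - ((q + 2) * e.1 + 1 + j)))
      (fun j hj => hW _ (by omega)) (fun i j hij hj => by dsimp only; omega)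
    refine h.2 _ (hmemE e he) _ (hW ((q + 2) * e.1 + 1 + j) (by omega))
      (heq.trans (hWp _ (by omega) hpj).symm) (Or.inl ⟨heq ▸ hps, ?_⟩)
    simp only [Prod.map_fst, Prod.map_snd]
    omega

/-! ### A program for the reductions -/

namespace Reduction

/-- The stacks of the reduction program: input, two unary counters, auxiliary stack, reversed
output, output. -/
inductive Stack
  | inp | x | y | tmp | rev | out
  deriving DecidableEq

instance : Fintype Stack :=
  ⟨{.inp, .x, .y, .tmp, .rev, .out}, fun k => by cases k <;> simp⟩

open Stack Prog

/-- Stacks with given contents. -/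
def stk (i x y t r o : List Bool) : Stack → List Bool
  | .inp => i
  | .x => x
  | .y => y
  | .tmp => t
  | .rev => r
  | .out => o

section

variable (i x y t r o l : List Bool)

@[simp] theorem update_inp : update (stk i x y t r o) inp l = stk l x y t r o := by
  funext k; cases k <;> rfl

@[simp] theorem update_x : update (stk i x y t r o) Stack.x l = stk i l y t r o := by
  funext k; cases k <;> rfl

@[simp] theorem update_y : update (stk i x y t r o) Stack.y l = stk i x l t r o := by
  funext k; cases k <;> rfl

@[simp] theorem update_rev : update (stk i x y t r o) rev l = stk i x y t l o := by
  funext k; cases k <;> rfl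

@[simp] theorem update_out : update (stk i x y t r o) out l = stk i x y t r l := by
  funext k; cases k <;> rfl

end

/-- A program fragment of the reduction program; its internal state is the last popped symbol. -/
abbrev Frag : Type 1 := Prog (fun _ : Stack => Bool) (Option Bool)

/-- Pop a symbol into the internal state. -/
def popTo (k : Stack) : Frag := pop k fun _ a => a

/-- Push a fixed list, its last symbol first. -/
def pushList (k : Stack) : List Bool → Frag
  | [] => skip
  | b :: l => seq (pushList k l) (push k fun _ => b)

theorem runs_pushList (k : Stack) (l : List Bool) (v : Option Bool) (S : Stack → List Bool) :
    Runs (pushList k l) v S v (update S k (l ++ S k)) 0 := by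
  induction l with
  | nil => exact runs_skip.cast rfl (by simp) le_rfl
  | cons b l ih => exact (ih.seq (runs_push k _)).cast rfl (by simp) le_rfl

/-- Empty a stack. -/
def clear (k : Stack) : Frag := loop (popTo k) Option.isSome skip

theorem runs_clear (k : Stack) (v : Option Bool) (S : Stack → List Bool) :
    Runs (clear k) v S none (update S k []) ((S k).length + 1) := by
  generalize hl : S k = l
  induction l generalizing v S with
  | nil =>
    have h := runs_pop (Γ := fun _ : Stack => Bool) (v := v) (S := S) k fun _ a => a
    rw [hl] at h
    exact h.loop_exit rfl
  | cons a l ih =>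
    have h := runs_pop (Γ := fun _ : Stack => Bool) (v := v) (S := S) k fun _ a => a
    rw [hl] at h
    exact (h.loop_step rfl runs_skip (ih (some a) (update S k l) (by simp))).cast rfl (by simp)
      (by simp)

theorem replicate_append_cons (n : ℕ) (b : Bool) (l : List Bool) :
    List.replicate n b ++ b :: l = List.replicate (n + 1) b ++ l := by
  rw [List.replicate_succ', List.append_assoc, List.singleton_append]

/-- Append the content of a unary counter to the output. -/
def emitCounter (k : Stack) : Frag :=
  seq (loop (popTo k) Option.isSome (seq (pushList tmp [true]) (pushList rev [true])))
    (move tmp k (fun _ a => a) Option.isSome fun v => v.getD false)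

theorem runs_emitCounter {k : Stack} (hk : k ≠ tmp) (hk' : k ≠ rev) (n : ℕ) (v : Option Bool)
    (S : Stack → List Bool) (hS : S k = List.replicate n true) (ht : S tmp = []) :
    Runs (emitCounter k) v S none (update S rev (List.replicate n true ++ S rev)) (2 * n + 2) := by
  have h : ∀ (n : ℕ) (v : Option Bool) (S : Stack → List Bool), S k = List.replicate n true →
      Runs (loop (popTo k) Option.isSome (seq (pushList tmp [true]) (pushList rev [true]))) v S
        none (update (update (update S k []) tmp (List.replicate n true ++ S tmp)) rev
          (List.replicate n true ++ S rev)) (n + 1) := by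
    intro n
    induction n with
    | zero =>
      intro v S hS
      have h := runs_pop (Γ := fun _ : Stack => Bool) (v := v) (S := S) k fun _ a => a
      rw [hS] at h
      refine (h.loop_exit rfl).cast rfl ?_ (by simp)
      funext j
      cases j <;> simp [update_apply] <;> grind
    | succ n ih =>
      intro v S hS
      have h := runs_pop (Γ := fun _ : Stack => Bool) (v := v) (S := S) k fun _ a => a
      rw [hS] at h
      refine (h.loop_step rfl ((runs_pushList _ _ _ _).seq (runs_pushList _ _ _ _))
        (ih _ _ ?_)).cast rfl ?_ (by omega)
      · simp [hk, hk', List.replicate_succ]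
      · funext j
        by_cases h₁ : j = rev
        · subst h₁; simp [replicate_append_cons, hk'.symm]
        · by_cases h₂ : j = tmp
          · subst h₂; simp [replicate_append_cons, hk.symm]
          · by_cases h₃ : j = k
            · subst h₃; simp [h₁, h₂]
            · simp [h₁, h₂, h₃]
  refine ((h n v S hS).seq (runs_move hk.symm id (by simp) (by simp) (by simp) (by simp) _ _)).cast
    rfl ?_ ?_
  · funext j
    by_cases h₁ : j = rev
    · subst h₁; simp [hk'.symm]
    · by_cases h₂ : j = tmp
      · subst h₂; simp [hk.symm, ht]
      · by_cases h₃ : j = k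
        · subst h₃; simp [h₁, h₂, ht, hS]
        · simp [h₁, h₂, h₃]
  · simp [ht]; omega

/-- A number `x + y + k` in which the summands `x` and `y`, the values of the counters, may be
missing. -/
structure Term where
  /-- whether `x` is a summand -/
  useX : Bool
  /-- whether `y` is a summand -/
  useY : Bool
  /-- the constant summand -/
  const : ℕ

/-- The value of a term. -/
def Term.eval (a : Term) (x y : ℕ) : ℕ :=
  (if a.useX then x else 0) + (if a.useY then y else 0) + a.const

theorem reverse_encodeUnary (k : ℕ) : (encodeUnary k).reverse = false :: List.replicate k true := by
  simp [encodeUnary]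

/-- Append the unary string of a term to the output. -/
def emitTerm (a : Term) : Frag :=
  seq (if a.useX then emitCounter Stack.x else skip) <|
  seq (if a.useY then emitCounter Stack.y else skip) <|
  seq (pushList rev (false :: List.replicate a.const true)) (load fun _ => none)

/-- Stacks in the course of the program: the remaining input, the counters, the reversed output. -/
abbrev work (i : List Bool) (x y : ℕ) (r : List Bool) : Stack → List Bool :=
  stk i (List.replicate x true) (List.replicate y true) [] r []

variable (i r : List Bool) (x y : ℕ) (v : Option Bool)

theorem runs_emitTerm (a : Term) :
    Runs (emitTerm a) v (work i x y r) none (work i x y ((encodeUnary (a.eval x y)).reverse ++ r))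
      (2 * (x + y) + 4) := by
  have h₁ : ∃ v', Runs (if a.useX then emitCounter Stack.x else skip) v (work i x y r) v'
      (work i x y (List.replicate (if a.useX then x else 0) true ++ r)) (2 * x + 2) := by
    cases a.useX
    · exact ⟨_, runs_skip.cast rfl (by simp) (by omega)⟩
    · exact ⟨none, (runs_emitCounter (by simp) (by simp) x v _ rfl rfl).cast rfl
        (by simp [work, stk]) le_rfl⟩
  obtain ⟨v₁, h₁⟩ := h₁
  have h₂ (r : List Bool) : ∃ v', Runs (if a.useY then emitCounter Stack.y else skip) v₁
      (work i x y r) v' (work i x y (List.replicate (if a.useY then y else 0) true ++ r))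
      (2 * y + 2) := by
    cases a.useY
    · exact ⟨_, runs_skip.cast rfl (by simp) (by omega)⟩
    · exact ⟨none, (runs_emitCounter (by simp) (by simp) y v₁ _ rfl rfl).cast rfl
        (by simp [work, stk]) le_rfl⟩
  obtain ⟨v₂, h₂⟩ := h₂ (List.replicate (if a.useX then x else 0) true ++ r)
  refine (h₁.seq (h₂.seq ((runs_pushList _ _ _ _).seq (runs_load _)))).cast rfl ?_ (by omega)
  simp only [work, update_rev, reverse_encodeUnary, Term.eval]
  simp [stk, ← List.append_assoc, Nat.add_comm]

/-- Append the unary strings of a list of pairs of terms to the output. -/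
def emitPairs : List (Term × Term) → Frag
  | [] => load fun _ => none
  | a :: l => seq (seq (emitTerm a.1) (emitTerm a.2)) (emitPairs l)

/-- The pairs of values of a list of pairs of terms. -/
def evalPairs (l : List (Term × Term)) (x y : ℕ) : List (ℕ × ℕ) :=
  l.map fun a => (a.1.eval x y, a.2.eval x y)

theorem runs_emitPairs (l : List (Term × Term)) :
    Runs (emitPairs l) v (work i x y r) none
      (work i x y (((evalPairs l x y).flatMap encodePair).reverse ++ r))
      (l.length * (4 * (x + y) + 8)) := by
  induction l generalizing r v with
  | nil => exact (runs_load _).cast rfl (by simp [evalPairs]) (by simp)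
  | cons a l ih =>
    refine (((runs_emitTerm i r x y v a.1).seq (runs_emitTerm i _ x y none a.2)).seq
      (ih _ none)).cast rfl ?_ ?_
    · simp [evalPairs, encodePair]
    · rw [List.length_cons, Nat.add_mul]; omega

/-- Append the edges of the rainbow between the counters to the output. -/
def emitRainbow : Frag :=
  loop (popTo Stack.x) Option.isSome <|
    seq (seq (emitTerm ⟨true, false, 0⟩) (emitTerm ⟨false, true, 0⟩)) (pushList Stack.y [true])

theorem runs_emitRainbow {b : ℕ} (hb : x + y ≤ b) :
    Runs emitRainbow v (work i x y r) none
      (work i 0 (x + y) (((rainbow x y).flatMap encodePair).reverse ++ r))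
      (x * (4 * b + 9) + 1) := by
  induction x generalizing y r v with
  | zero =>
    have h := runs_pop (Γ := fun _ : Stack => Bool) (v := v) (S := work i 0 y r) Stack.x
      fun _ a => a
    exact (h.loop_exit rfl).cast rfl (by simp [rainbow, work, stk]) (by simp)
  | succ x ih =>
    have h := runs_pop (Γ := fun _ : Stack => Bool) (v := v) (S := work i (x + 1) y r) Stack.x
      fun _ a => a
    have e : update (work i (x + 1) y r) Stack.x (work i (x + 1) y r Stack.x).tail =
        work i x y r := by simp [work, stk]
    rw [e] at h
    have h₁ := ((runs_emitTerm i r x y (some true) ⟨true, false, 0⟩).seq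
      (runs_emitTerm i _ x y none ⟨false, true, 0⟩)).seq (runs_pushList Stack.y [true] _ _)
    refine (h.loop_step rfl (h₁.cast rfl ?_ le_rfl) (ih ((encodeUnary y).reverse ++
      ((encodeUnary x).reverse ++ r)) (y + 1) none (by omega))).cast rfl ?_ ?_
    · simp [work, stk, Term.eval, List.replicate_succ]
    · simp [rainbow, encodePair, Nat.add_comm, Nat.add_left_comm]
    · rw [Nat.add_mul x 1]; omega

/-- The image of the string of edges under `a ↦ c * a + d`, symbol by symbol. -/
def scale (c d : ℕ) : Bool → List Bool
  | true => List.replicate c true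
  | false => encodeUnary d

theorem flatMap_scale_encodeUnary (c d k : ℕ) :
    (encodeUnary k).flatMap (scale c d) = encodeUnary (c * k + d) := by
  have : (List.replicate k true).flatMap (scale c d) = List.replicate (c * k) true := by
    induction k with
    | zero => simp
    | succ k ih =>
      rw [List.replicate_succ, List.flatMap_cons, ih, Nat.mul_succ, Nat.add_comm,
        List.replicate_add]
      rfl
  rw [encodeUnary, List.flatMap_append, this]
  simp [scale, encodeUnary, ← List.append_assoc]

theorem flatMap_scale_encodePair (c d : ℕ) (E : List (ℕ × ℕ)) :
    (E.flatMap encodePair).flatMap (scale c d) =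
      (E.map (Prod.map (fun a => c * a + d) fun a => c * a + d)).flatMap encodePair := by
  induction E with
  | nil => rfl
  | cons e E ih =>
    rw [List.flatMap_cons, List.flatMap_append, ih, List.map_cons, List.flatMap_cons, encodePair,
      List.flatMap_append, flatMap_scale_encodeUnary, flatMap_scale_encodeUnary]
    rfl

/-- Append the image of the remaining input under `a ↦ c * a + d` to the output. -/
def emitInput (c d : ℕ) : Frag :=
  loop (popTo inp) Option.isSome <|
    branch (fun v => v.getD false) (pushList rev (scale c d true).reverse)
      (pushList rev (scale c d false).reverse)

theorem runs_emitInput (c d : ℕ) :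
    Runs (emitInput c d) v (work i x y r) none
      (work [] x y ((i.flatMap (scale c d)).reverse ++ r)) (i.length + 1) := by
  induction i generalizing r v with
  | nil =>
    have h := runs_pop (Γ := fun _ : Stack => Bool) (v := v) (S := work [] x y r) inp fun _ a => a
    exact (h.loop_exit rfl).cast rfl (by simp [stk]) (by simp)
  | cons b i ih =>
    have h := runs_pop (Γ := fun _ : Stack => Bool) (v := v) (S := work (b :: i) x y r) inp
      fun _ a => a
    have e : update (work (b :: i) x y r) inp (work (b :: i) x y r inp).tail = work i x y r := by
      simp [work, stk]
    rw [e] at h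
    have h₁ : Runs (branch (fun v => v.getD false) (pushList rev (scale c d true).reverse)
        (pushList rev (scale c d false).reverse)) (some b) (work i x y r) (some b)
        (work i x y ((scale c d b).reverse ++ r)) 0 := by
      cases b
      · exact ((runs_pushList _ _ _ _).branch_false rfl).cast rfl (by simp [stk]) le_rfl
      · exact ((runs_pushList _ _ _ _).branch_true rfl).cast rfl (by simp [stk]) le_rfl
    exact (h.loop_step rfl h₁ (ih _ _)).cast rfl (by simp) (by simp)

/-- Read a unary number `n` from the input, and set both counters to `c * n`. -/
def readCounters (c : ℕ) : Frag :=
  loop (popTo inp) (fun v => v.getD false)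
    (seq (pushList Stack.x (List.replicate c true)) (pushList Stack.y (List.replicate c true)))

theorem runs_readCounters (c n : ℕ) :
    Runs (readCounters c) v (work (encodeUnary n ++ i) x y r) (some false)
      (work i (c * n + x) (c * n + y) r) (n + 1) := by
  induction n generalizing x y v with
  | zero =>
    have h := runs_pop (Γ := fun _ : Stack => Bool) (v := v)
      (S := work (encodeUnary 0 ++ i) x y r) inp fun _ a => a
    exact (h.loop_exit rfl).cast rfl (by simp [stk, encodeUnary]) (by simp)
  | succ n ih =>
    have h := runs_pop (Γ := fun _ : Stack => Bool) (v := v)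
      (S := work (encodeUnary (n + 1) ++ i) x y r) inp fun _ a => a
    refine (h.loop_step rfl (((runs_pushList _ _ _ _).seq (runs_pushList _ _ _ _)).cast rfl ?_
      le_rfl) (ih (c + x) (c + y) _)).cast rfl ?_ (by omega)
    · simp [work, stk, encodeUnary, List.replicate_succ]
    · rw [Nat.mul_succ, Nat.add_assoc, Nat.add_assoc]

/-- The reduction program: read the number `n` of vertices and set the counters to `x = c * n` and
`y = c * n + h`; then write the term `N`, the pairs of terms `L`, the rainbow between the counters
if `w` is set, and the image of the edges under `a ↦ c * a + d`. -/
def prog (c d h : ℕ) (N : Term) (L : List (Term × Term)) (w : Bool) : Frag :=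
  seq (readCounters c) <| seq (pushList Stack.y (List.replicate h true)) <| seq (emitTerm N) <|
  seq (emitPairs L) <| seq (if w then emitRainbow else skip) <| seq (emitInput c d) <|
  seq (clear Stack.x) <| seq (clear Stack.y) <|
  move rev out (fun _ a => a) Option.isSome fun v => v.getD false

/-- The edges that the reduction program writes. -/
def outEdges (c d h : ℕ) (L : List (Term × Term)) (w : Bool) (n : ℕ) (E : List (ℕ × ℕ)) :
    List (ℕ × ℕ) :=
  (evalPairs L (c * n) (c * n + h) ++ if w then rainbow (c * n) (c * n + h) else []) ++
    E.map (Prod.map (fun a => c * a + d) fun a => c * a + d)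

/-- The string that the reduction program writes. -/
def output (c d h : ℕ) (N : Term) (L : List (Term × Term)) (w : Bool) (n : ℕ) (E : List (ℕ × ℕ)) :
    List Bool :=
  encodeUnary (N.eval (c * n) (c * n + h)) ++ (outEdges c d h L w n E).flatMap encodePair

theorem length_encodeUnary (k : ℕ) : (encodeUnary k).length = k + 1 := by simp [encodeUnary]

theorem Term.eval_le (a : Term) (x y : ℕ) : a.eval x y ≤ x + y + a.const := by
  unfold Term.eval
  split_ifs <;> omega

theorem length_evalPairs_le (L : List (Term × Term)) (x y : ℕ) :
    ((evalPairs L x y).flatMap encodePair).length ≤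
      L.length * (2 * (x + y) + 2) + (L.map fun a => a.1.const + a.2.const).sum := by
  induction L with
  | nil => simp [evalPairs]
  | cons a L ih =>
    have h₁ := a.1.eval_le x y
    have h₂ := a.2.eval_le x y
    simp only [evalPairs, List.map_cons, List.flatMap_cons, List.length_append, encodePair,
      length_encodeUnary, List.sum_cons, List.length_cons] at ih ⊢
    rw [Nat.add_mul]
    omega

theorem length_rainbow (x y : ℕ) :
    ((rainbow x y).flatMap encodePair).length = x * (x + y + 1) := by
  induction x generalizing y with
  | zero => simp [rainbow]
  | succ x ih =>
    simp only [rainbow, List.flatMap_cons, List.length_append, encodePair, length_encodeUnary, ih]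
    ring

theorem length_scale_le (c d : ℕ) (l : List Bool) :
    (l.flatMap (scale c d)).length ≤ l.length * (c + d + 1) := by
  induction l with
  | nil => simp
  | cons b l ih =>
    have : (scale c d b).length ≤ c + d + 1 := by
      cases b
      · simp [scale, length_encodeUnary]
      · simp only [scale, List.length_replicate]; omega
    rw [List.flatMap_cons, List.length_append, List.length_cons, Nat.add_mul]
    omega

/-- A bound for the length of the output; `m` is the length of the input after the number of
vertices, and `s` the sum of the counters. -/
theorem length_output_le (c d h : ℕ) (N : Term) (L : List (Term × Term)) (w : Bool) (n : ℕ)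
    (E : List (ℕ × ℕ)) {m s : ℕ} (hm : (E.flatMap encodePair).length ≤ m)
    (hs : c * n + (c * n + h) ≤ s) :
    (output c d h N L w n E).length ≤ (s + N.const + 1) + (L.length * (2 * s + 2) +
      (L.map fun a => a.1.const + a.2.const).sum) + s * (s + 1) + m * (c + d + 1) := by
  have h₁ := N.eval_le (c * n) (c * n + h)
  have h₂ := length_evalPairs_le L (c * n) (c * n + h)
  have h₃ := length_scale_le c d (E.flatMap encodePair)
  have h₄ : ((if w then rainbow (c * n) (c * n + h) else []).flatMap encodePair).length ≤
      s * (s + 1) := by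
    cases w
    · simp
    · simp only [if_true, length_rainbow]
      exact Nat.mul_le_mul (by omega) (by omega)
  have h₅ : L.length * (2 * (c * n + (c * n + h)) + 2) ≤ L.length * (2 * s + 2) :=
    Nat.mul_le_mul_left _ (by omega)
  have h₆ : (E.flatMap encodePair).length * (c + d + 1) ≤ m * (c + d + 1) :=
    Nat.mul_le_mul_right _ hm
  rw [output, outEdges, List.flatMap_append, List.flatMap_append, ← flatMap_scale_encodePair]
  simp only [List.length_append, length_encodeUnary]
  omega

theorem runs_prog (c d h : ℕ) (N : Term) (L : List (Term × Term)) (w : Bool) (n : ℕ)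
    (E : List (ℕ × ℕ)) {m s : ℕ} (hm : (E.flatMap encodePair).length ≤ m)
    (hs : c * n + (c * n + h) ≤ s) :
    Runs (prog c d h N L w) none
      (update (fun _ => []) inp (encodeUnary n ++ E.flatMap encodePair)) none
      (update (fun _ => []) out (output c d h N L w n E))
      ((n + 1) + (2 * s + 4) + L.length * (4 * s + 8) + (s * (4 * s + 9) + 1) + (m + 1) + (s + 2) +
        ((output c d h N L w n E).length + 1)) := by
  let i := E.flatMap encodePair
  let x := c * n
  let y := c * n + h
  have e₀ : (fun _ => [] : Stack → List Bool) = work [] 0 0 [] := by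
    funext k; cases k <;> rfl
  rw [e₀, update_inp, update_out]
  have r₁ := runs_readCounters i [] 0 0 none c n
  have r₂ : Runs (pushList Stack.y (List.replicate h true)) (some false)
      (work i (c * n + 0) (c * n + 0) []) (some false) (work i x y []) 0 :=
    (runs_pushList _ _ _ _).cast rfl (by simp [stk, x, y, Nat.add_comm]) le_rfl
  have r₃ := runs_emitTerm i [] x y (some false) N
  have r₄ := runs_emitPairs i ((encodeUnary (N.eval x y)).reverse ++ []) x y none L
  have r₅ (r : List Bool) : ∃ x' y', x' + y' = x + y ∧
      Runs (if w then emitRainbow else skip) none (work i x y r) none (work i x' y'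
        (((if w then rainbow x y else []).flatMap encodePair).reverse ++ r))
        (x * (4 * (x + y) + 9) + 1) := by
    cases w
    · exact ⟨x, y, rfl, runs_skip.cast rfl (by simp) (by omega)⟩
    · exact ⟨0, x + y, by omega, runs_emitRainbow i r x y none le_rfl⟩
  obtain ⟨x', y', hxy, r₅⟩ := r₅ (((evalPairs L x y).flatMap encodePair).reverse ++
    ((encodeUnary (N.eval x y)).reverse ++ []))
  have r₆ := runs_emitInput i (((if w then rainbow x y else []).flatMap encodePair).reverse ++
    (((evalPairs L x y).flatMap encodePair).reverse ++
    ((encodeUnary (N.eval x y)).reverse ++ []))) x' y' none c d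
  have e₁ : (i.flatMap (scale c d)).reverse ++
      (((if w then rainbow x y else []).flatMap encodePair).reverse ++
        (((evalPairs L x y).flatMap encodePair).reverse ++
          ((encodeUnary (N.eval x y)).reverse ++ []))) = (output c d h N L w n E).reverse := by
    simp only [output, outEdges, List.flatMap_append, List.reverse_append, i,
      flatMap_scale_encodePair, List.append_nil, List.append_assoc, x, y]
  rw [e₁] at r₆
  have r₇ := runs_clear Stack.x none (work [] x' y' (output c d h N L w n E).reverse)
  rw [update_x] at r₇
  have r₈ := runs_clear Stack.y none (stk [] [] (List.replicate y' true) []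
    (output c d h N L w n E).reverse [])
  rw [update_y] at r₈
  have r₉ := runs_move (Γ := fun _ : Stack => Bool) (k := rev) (k' := out) (by simp)
    (f := fun _ a => a) (c := Option.isSome) (g := fun v => v.getD false) id (by simp) (by simp)
    (by simp) (by simp) none (stk [] [] [] [] (output c d h N L w n E).reverse [])
  refine (r₁.seq (r₂.seq (r₃.seq (r₄.seq (r₅.seq (r₆.seq (r₇.seq (r₈.seq r₉)))))))).cast rfl ?_ ?_
  · simp [stk]
  · have h₁ : L.length * (4 * (x + y) + 8) ≤ L.length * (4 * s + 8) :=
      Nat.mul_le_mul_left _ (by omega)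
    have h₂ : x * (4 * (x + y) + 9) ≤ s * (4 * s + 9) := Nat.mul_le_mul (by omega) (by omega)
    have h₃ : (work [] x' y' (output c d h N L w n E).reverse Stack.x).length = x' := by
      simp [work, stk]
    have h₄ : (stk [] [] (List.replicate y' true) [] (output c d h N L w n E).reverse []
      Stack.y).length = y' := by simp [stk]
    have h₅ : (stk [] [] [] [] (output c d h N L w n E).reverse [] rev).length =
      (output c d h N L w n E).length := by simp [stk]
    rw [h₃, h₄, h₅]
    have h₆ : i.length ≤ m := hm
    omega

/-- A function on instances that the reduction program computes is computable in polynomial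
time. -/
theorem computable (c d h : ℕ) (N : Term) (L : List (Term × Term)) (w : Bool)
    (f : OrderedGraph → OrderedGraph)
    (hn : ∀ I, (f I).n = N.eval (c * I.n) (c * I.n + h))
    (hE : ∀ I, (f I).natEdges = outEdges c d h L w I.n I.natEdges) :
    Nonempty (TM2ComputableInPolyTime OrderedGraph.encode OrderedGraph.encode f) := by
  let S : Polynomial ℕ := Polynomial.C (2 * c) * Polynomial.X + Polynomial.C h
  let O : Polynomial ℕ := (S + Polynomial.C N.const + 1) + (Polynomial.C L.length * (2 * S + 2) +
    Polynomial.C (L.map fun a => a.1.const + a.2.const).sum) + S * (S + 1) +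
    Polynomial.X * Polynomial.C (c + d + 1)
  let T : Polynomial ℕ := (Polynomial.X + 1) + (2 * S + 4) + Polynomial.C L.length * (4 * S + 8) +
    (S * (4 * S + 9) + 1) + (Polynomial.X + 1) + (S + 2) + (O + 1)
  refine computable_toTM (p := prog c d h N L w) (k₀ := inp) (k₁ := out) (v := none)
    (Equiv.refl Bool) (Equiv.refl Bool) T fun I => ?_
  have hlen : I.n + 1 + (I.natEdges.flatMap encodePair).length = I.encode.length := by
    rw [I.encode_eq, List.length_append, length_encodeUnary]
  have hs : c * I.n + (c * I.n + h) ≤ S.eval I.encode.length := by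
    have : c * I.n ≤ c * I.encode.length := Nat.mul_le_mul_left _ (by omega)
    simp only [S, Polynomial.eval_add, Polynomial.eval_mul, Polynomial.eval_C, Polynomial.eval_X,
      Nat.mul_assoc]
    omega
  have hm : (I.natEdges.flatMap encodePair).length ≤ I.encode.length := by omega
  have hO := length_output_le c d h N L w I.n I.natEdges hm hs
  have hid (l : List Bool) : l.map (Equiv.refl Bool).symm = l := List.map_id l
  rw [hid, hid, (f I).encode_eq, hn, hE]
  rw [show encodeUnary (N.eval (c * I.n) (c * I.n + h)) ++
    (outEdges c d h L w I.n I.natEdges).flatMap encodePair = output c d h N L w I.n I.natEdges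
    from rfl]
  rw [I.encode_eq]
  refine (runs_prog c d h N L w I.n I.natEdges hm hs).mono ?_
  rw [← I.encode_eq]
  simp only [T, O, Polynomial.eval_add, Polynomial.eval_mul, Polynomial.eval_C, Polynomial.eval_X,
    Polynomial.eval_ofNat, Polynomial.eval_one]
  omega

end Reduction

/-! ### The reductions -/

section

open Reduction

theorem polyTimeReducible_queue (s q : ℕ) :
    PolyTimeReducible OrderedGraph.encode (FixedOrderMixedLayout s q)
      OrderedGraph.encode (FixedOrderMixedLayout s (q + 1)) := by
  let L : List (Term × Term) := (List.range (s + 1)).map fun i =>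
    (⟨false, false, i⟩, ⟨true, false, s + 1 + i⟩)
  have hL (n : ℕ) : evalPairs L (1 * n) (1 * n + 0) = twist (s + 1) n := by
    simp [evalPairs, L, twist, Term.eval, Function.comp_def]
  let f (I : OrderedGraph) : OrderedGraph := OrderedGraph.ofNatEdges (I.n + 2 * (s + 1))
    (twist (s + 1) I.n ++ I.natEdges.map
      (Prod.map (fun a => 1 * a + (s + 1)) fun a => 1 * a + (s + 1)))
    (fun e he => by
      rcases List.mem_append.1 he with he | he
      · rw [mem_twist] at he; omega
      · obtain ⟨e, he₀, rfl⟩ := List.mem_map.1 he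
        have := I.lt_of_mem_natEdges he₀
        simp only [Prod.map_fst, Prod.map_snd]
        omega)
    (by
      refine List.Nodup.append (nodup_twist _ _) (I.nodup_natEdges.map ?_) ?_
      · refine Function.Injective.prodMap ?_ ?_ <;> intro a b h <;> dsimp only at h <;> omega
      · intro e he he'
        obtain ⟨e, -, rfl⟩ := List.mem_map.1 he'
        rw [mem_twist, Prod.map_fst] at he
        omega)
  refine ⟨f, computable 1 (s + 1) 0 ⟨true, false, 2 * (s + 1)⟩ L false f (fun I => ?_) fun I => ?_,
    fun I => ?_⟩
  · simp [f, OrderedGraph.ofNatEdges, Term.eval]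
  · simp [f, outEdges, ← hL]
  · rw [fixedOrderMixedLayout_iff, fixedOrderMixedLayout_iff, exists_isPaging_twist s q I.n
      fun e he => I.lt_of_mem_natEdges he]
    simp only [f, OrderedGraph.natEdges_ofNatEdges]

theorem polyTimeReducible_stack (s q : ℕ) :
    PolyTimeReducible OrderedGraph.encode (FixedOrderMixedLayout s q)
      OrderedGraph.encode (FixedOrderMixedLayout (s + 1) q) := by
  let L : List (Term × Term) := (List.range s).flatMap fun b => (List.range (q + 1)).map fun j =>
    (⟨true, false, b * (q + 1) + j⟩, ⟨true, true, b * (q + 1) + (q - j)⟩)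
  have hL (x y : ℕ) : evalPairs L x y = rainbows s q x y := by
    simp [evalPairs, L, rainbows, Term.eval, List.map_flatMap, Function.comp_def]
  have hmul {a b : ℕ} (h : a < b) : (q + 2) * a + (q + 2) ≤ (q + 2) * b := by
    have : (q + 2) * (a + 1) ≤ (q + 2) * b := Nat.mul_le_mul_left _ h
    rwa [Nat.mul_add, Nat.mul_one] at this
  have hblock {b : ℕ} (hb : b < s) : b * (q + 1) + (q + 1) ≤ s * (q + 1) := by
    have : (b + 1) * (q + 1) ≤ s * (q + 1) := Nat.mul_le_mul_right _ hb
    rwa [Nat.add_mul, Nat.one_mul] at this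
  let f (I : OrderedGraph) : OrderedGraph := OrderedGraph.ofNatEdges
    ((q + 2) * I.n + ((q + 2) * I.n + s * (q + 1)) + s * (q + 1))
    ((rainbows s q ((q + 2) * I.n) ((q + 2) * I.n + s * (q + 1)) ++
        rainbow ((q + 2) * I.n) ((q + 2) * I.n + s * (q + 1))) ++ I.natEdges.map
      (Prod.map (fun a => (q + 2) * a + 0) fun a => (q + 2) * a + 0))
    (fun e he => by
      rcases List.mem_append.1 he with he | he
      · rcases List.mem_append.1 he with he | he
        · obtain ⟨b, hb, j, hj, rfl⟩ := mem_rainbows.1 he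
          have := hblock hb
          dsimp only
          omega
        · rw [mem_rainbow] at he; omega
      · obtain ⟨e, he₀, rfl⟩ := List.mem_map.1 he
        have h₁ := hmul (I.lt_of_mem_natEdges he₀).1
        have h₂ := hmul (I.lt_of_mem_natEdges he₀).2
        simp only [Prod.map_fst, Prod.map_snd]
        omega)
    (by
      refine List.Nodup.append (List.Nodup.append (nodup_rainbows _ _ _ _) (nodup_rainbow _ _) ?_)
        (I.nodup_natEdges.map ?_) ?_
      · intro e he he'
        obtain ⟨b, hb, j, hj, rfl⟩ := mem_rainbows.1 he
        rw [mem_rainbow] at he'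
        dsimp only at he'
        omega
      · have : Function.Injective fun a => (q + 2) * a + 0 := fun a b h =>
          Nat.eq_of_mul_eq_mul_left (by omega) h
        exact this.prodMap this
      · intro e he he'
        obtain ⟨e, he₀, rfl⟩ := List.mem_map.1 he'
        have h₁ := hmul (I.lt_of_mem_natEdges he₀).1
        have h₂ := hmul (I.lt_of_mem_natEdges he₀).2
        rcases List.mem_append.1 he with he | he
        · obtain ⟨b, hb, j, hj, he⟩ := mem_rainbows.1 he
          simp only [Prod.map_apply', Prod.mk.injEq] at he
          omega
        · rw [mem_rainbow, Prod.map_fst, Prod.map_snd] at he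
          omega)
  refine ⟨f, computable (q + 2) 0 (s * (q + 1)) ⟨true, true, s * (q + 1)⟩ L true f (fun I => ?_)
    fun I => ?_, fun I => ?_⟩
  · simp [f, OrderedGraph.ofNatEdges, Term.eval]
  · simp [f, outEdges, hL]
  · rw [fixedOrderMixedLayout_iff, fixedOrderMixedLayout_iff, exists_isPaging_rainbows s q I.n
      fun e he => I.lt_of_mem_natEdges he]
    simp only [f, OrderedGraph.natEdges_ofNatEdges]

end

theorem PolyTimeReducible.trans {α β γ A B C : Type} {ea : α → List A} {eb : β → List B}
    {ec : γ → List C} {P : α → Prop} {Q : β → Prop} {R : γ → Prop}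
    (h : PolyTimeReducible ea P eb Q) (h' : PolyTimeReducible eb Q ec R) :
    PolyTimeReducible ea P ec R := by
  obtain ⟨f, ⟨cf⟩, hf⟩ := h
  obtain ⟨g, ⟨cg⟩, hg⟩ := h'
  exact ⟨g ∘ f, TM2ComputableInPolyTime.comp cf cg, fun x => (hf x).trans (hg (f x))⟩

/-! ### A program for the verifier -/

namespace Verifier

/-- The stacks of the verifier: input, reversed string of edges, string of edges, the endpoints of
the current edge with an auxiliary stack for each, the part of a page that has been scanned, the
pages, output. -/
inductive Stack (N : ℕ)
  | inp | rev | edges | a | a₂ | b | b₂ | scan | page (i : Fin N) | out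
  deriving DecidableEq

instance (N : ℕ) : Fintype (Stack N) :=
  ⟨{.inp, .rev, .edges, .a, .a₂, .b, .b₂, .scan, .out} ∪ Finset.univ.image .page,
    fun k => by cases k <;> simp⟩

/-- The alphabet of the verifier's input. -/
abbrev Sym : Type := Option (Bool ⊕ Bool)

/-- The stack alphabets. -/
abbrev Alph (N : ℕ) : Stack N → Type
  | .inp => Sym
  | .rev | .edges | .a | .a₂ | .b | .b₂ | .scan | .page _ | .out => Bool

/-- The internal states: the last popped symbol, the page of the current edge, the results of the
last comparison of a number with `a` and `b` (`gtA` says that the number is greater than `a`) and of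
the one before, and whether no conflict has been found so far. -/
structure Reg (N : ℕ) where
  /-- the last popped symbol -/
  sym : Option Bool
  /-- the page of the current edge -/
  pg : Fin N
  /-- the number is greater than `a` -/
  gtA : Bool
  /-- the number is less than `a` -/
  ltA : Bool
  /-- the number is greater than `b` -/
  gtB : Bool
  /-- the number is less than `b` -/
  ltB : Bool
  /-- the number before is greater than `a` -/
  gtA₀ : Bool
  /-- the number before is less than `a` -/
  ltA₀ : Bool
  /-- the number before is less than `b` -/
  ltB₀ : Bool
  /-- no conflict has been found -/
  ok : Bool

noncomputable instance (N : ℕ) : Fintype (Reg N) :=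
  Fintype.ofInjective (β := Option Bool × Fin N × (Fin 8 → Bool))
    (fun r => (r.sym, r.pg, ![r.gtA, r.ltA, r.gtB, r.ltB, r.gtA₀, r.ltA₀, r.ltB₀, r.ok]))
    fun r r' h => by
      cases r
      cases r'
      simpa [and_assoc] using h

open Stack Prog

variable {N : ℕ}

/-- Stacks with given contents. -/
def stk (i : List Sym) (r e x x₂ y y₂ s : List Bool) (P : Fin N → List Bool) (o : List Bool) :
    ∀ k : Stack N, List (Alph N k)
  | .inp => i
  | .rev => r
  | .edges => e
  | .a => x
  | .a₂ => x₂
  | .b => y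
  | .b₂ => y₂
  | .scan => s
  | .page j => P j
  | .out => o

section

variable (i : List Sym) (r e x x₂ y y₂ s : List Bool) (P : Fin N → List Bool) (o l : List Bool)

@[simp] theorem update_inp (l : List Sym) :
    update (stk i r e x x₂ y y₂ s P o) inp l = stk l r e x x₂ y y₂ s P o := by
  funext k; cases k <;> rfl

@[simp] theorem update_rev :
    update (stk i r e x x₂ y y₂ s P o) rev l = stk i l e x x₂ y y₂ s P o := by
  funext k; cases k <;> rfl

@[simp] theorem update_edges :
    update (stk i r e x x₂ y y₂ s P o) edges l = stk i r l x x₂ y y₂ s P o := by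
  funext k; cases k <;> rfl

@[simp] theorem update_a :
    update (stk i r e x x₂ y y₂ s P o) a l = stk i r e l x₂ y y₂ s P o := by
  funext k; cases k <;> rfl

@[simp] theorem update_a₂ :
    update (stk i r e x x₂ y y₂ s P o) a₂ l = stk i r e x l y y₂ s P o := by
  funext k; cases k <;> rfl

@[simp] theorem update_b :
    update (stk i r e x x₂ y y₂ s P o) b l = stk i r e x x₂ l y₂ s P o := by
  funext k; cases k <;> rfl

@[simp] theorem update_b₂ :
    update (stk i r e x x₂ y y₂ s P o) b₂ l = stk i r e x x₂ y l s P o := by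
  funext k; cases k <;> rfl

@[simp] theorem update_scan :
    update (stk i r e x x₂ y y₂ s P o) scan l = stk i r e x x₂ y y₂ l P o := by
  funext k; cases k <;> rfl

@[simp] theorem update_page (j : Fin N) :
    update (stk i r e x x₂ y y₂ s P o) (page j) l = stk i r e x x₂ y y₂ s (update P j l) o := by
  funext k
  cases k with
  | page j' =>
    by_cases h : j' = j
    · subst h; simp [stk]
    · rw [update_of_ne (by simpa using h)]; simp [stk, h]
  | _ => rfl

@[simp] theorem update_out :
    update (stk i r e x x₂ y y₂ s P o) out l = stk i r e x x₂ y y₂ s P l := by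
  funext k; cases k <;> rfl

end

/-- A program fragment of the verifier. -/
abbrev Frag (N : ℕ) : Type 1 := Prog (Alph N) (Reg N)

/-- Move the content of a stack. -/
def shift (k k' : Stack N) (h : Alph N k = Bool := by rfl) (h' : Alph N k' = Bool := by rfl) :
    Frag N :=
  move k k' (fun v x => { v with sym := x.map (cast h) }) (fun v => v.sym.isSome)
    fun v => cast h'.symm (v.sym.getD false)

theorem runs_shift {k k' : Stack N} (hk : k ≠ k') (h : Alph N k = Bool) (h' : Alph N k' = Bool)
    (v : Reg N) (S : ∀ k, List (Alph N k)) :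
    Runs (shift k k' h h') v S { v with sym := none }
      (update (update S k []) k' (((S k).map (cast (h.trans h'.symm))).reverse ++ S k'))
      ((S k).length + 1) :=
  runs_move hk _ (by simp) (by simp) (by simp) (by simp) v S

/-- Pop a symbol from `a` to `a₂`, if there is one. -/
def popA : Frag N :=
  seq (pop a fun v x => { v with sym := x, gtA := v.gtA || x.isNone })
    (branch (fun v => v.sym.isSome) (push a₂ fun _ => true) skip)

/-- Pop a symbol from `b` to `b₂`, if there is one. -/
def popB : Frag N :=
  seq (pop b fun v x => { v with sym := x, gtB := v.gtB || x.isNone })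
    (branch (fun v => v.sym.isSome) (push b₂ fun _ => true) skip)

/-- Move the next number from page `i` to the scanned part, popping a symbol from `a` and one from
`b` for each of its digits. -/
def scanNumber (i : Fin N) : Frag N :=
  loop (pop (page i) fun v x => { v with sym := x }) (fun v => v.sym == some true)
    (seq (push scan fun _ => true) (seq popA popB))

/-- Compare the next number on page `i` with `a` and `b`, and move it to the scanned part. -/
def compare (i : Fin N) : Frag N :=
  seq (load fun v => { v with gtA := false, gtB := false }) <|
  seq (scanNumber i) <| seq (push scan fun _ => false) <|
  seq (peek a fun v x => { v with ltA := x.isSome }) <|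
  seq (peek b fun v x => { v with ltB := x.isSome }) <|
  seq (shift a₂ a) (shift b₂ b)

/-- Stacks in the course of the scan of a page: the remaining input and edges, the endpoints of the
current edge and what has been popped of them, the scanned part, the pages. -/
abbrev work (i : List Sym) (e : List Bool) (x x₂ y y₂ : ℕ) (s : List Bool) (P : Fin N → List Bool) :
    ∀ k : Stack N, List (Alph N k) :=
  stk i [] e (List.replicate x true) (List.replicate x₂ true) (List.replicate y true)
    (List.replicate y₂ true) s P []

variable (w : List Sym) (e : List Bool)

section

variable (x x₂ y y₂ : ℕ) (s : List Bool) (P : Fin N → List Bool) (v : Reg N)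

theorem runs_popA : Runs popA v (work w e x x₂ y y₂ s P)
    { v with sym := (List.replicate x true).head?, gtA := v.gtA || decide (x < 1) }
    (work w e (x - 1) (x₂ + min x 1) y y₂ s P) 0 := by
  have h := runs_pop (Γ := Alph N) (v := v) (S := work w e x x₂ y y₂ s P) a
    fun (v : Reg N) x => { v with sym := x, gtA := v.gtA || x.isNone }
  cases x with
  | zero => exact (h.seq (runs_skip.branch_false rfl)).cast rfl (by simp [work, stk]) le_rfl
  | succ x =>
    exact (h.seq ((runs_push _ _).branch_true rfl)).cast rfl
      (by simp [work, stk, List.replicate_succ]) le_rfl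

theorem runs_popB : Runs popB v (work w e x x₂ y y₂ s P)
    { v with sym := (List.replicate y true).head?, gtB := v.gtB || decide (y < 1) }
    (work w e x x₂ (y - 1) (y₂ + min y 1) s P) 0 := by
  have h := runs_pop (Γ := Alph N) (v := v) (S := work w e x x₂ y y₂ s P) b
    fun (v : Reg N) x => { v with sym := x, gtB := v.gtB || x.isNone }
  cases y with
  | zero => exact (h.seq (runs_skip.branch_false rfl)).cast rfl (by simp [work, stk]) le_rfl
  | succ y =>
    exact (h.seq ((runs_push _ _).branch_true rfl)).cast rfl
      (by simp [work, stk, List.replicate_succ]) le_rfl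

theorem runs_scanNumber (i : Fin N) (n : ℕ) (l : List Bool) (hP : P i = encodeUnary n ++ l) :
    Runs (scanNumber i) v (work w e x x₂ y y₂ s P)
      { v with sym := some false, gtA := v.gtA || decide (x < n), gtB := v.gtB || decide (y < n) }
      (work w e (x - n) (x₂ + min x n) (y - n) (y₂ + min y n) (List.replicate n true ++ s)
        (update P i l)) (n + 1) := by
  induction n generalizing x x₂ y y₂ s P v with
  | zero =>
    have h := runs_pop (Γ := Alph N) (v := v) (S := work w e x x₂ y y₂ s P) (page i)
      fun (v : Reg N) x => { v with sym := x }
    have e₁ : work w e x x₂ y y₂ s P (page i) = false :: l := by simp [stk, hP, encodeUnary]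
    rw [e₁] at h
    exact (h.loop_exit rfl).cast (by simp) (by simp) le_rfl
  | succ n ih =>
    have h := runs_pop (Γ := Alph N) (v := v) (S := work w e x x₂ y y₂ s P) (page i)
      fun (v : Reg N) x => { v with sym := x }
    have e₁ : work w e x x₂ y y₂ s P (page i) = true :: (encodeUnary n ++ l) := by
      simp [stk, hP, encodeUnary, List.replicate_succ]
    rw [e₁] at h
    let P' := update P i (encodeUnary n ++ l)
    have hp : Runs (push scan fun _ : Reg N => true) { v with sym := some true }
        (work w e x x₂ y y₂ s P') { v with sym := some true }
        (work w e x x₂ y y₂ (true :: s) P') 0 :=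
      (runs_push (Γ := Alph N) scan _).cast rfl (by simp [work, stk]) le_rfl
    have h₁ := hp.seq ((runs_popA w e x x₂ y y₂ (true :: s) P' _).seq
      (runs_popB w e (x - 1) (x₂ + min x 1) y y₂ (true :: s) P' _))
    have h₂ := ih (x - 1) (x₂ + min x 1) (y - 1) (y₂ + min y 1) (true :: s) P'
      { v with
        sym := (List.replicate y true).head?
        gtA := v.gtA || decide (x < 1)
        gtB := v.gtB || decide (y < 1) } (by simp [P'])
    have h₀ := h.cast (v'' := { v with sym := some true }) (S'' := work w e x x₂ y y₂ s P')
      (t' := 0) (by simp) (by simp [P']) le_rfl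
    refine (h₀.loop_step rfl h₁ h₂).cast ?_ ?_ ?_
    · have ha : (v.gtA || decide (x < 1) || decide (x - 1 < n)) =
          (v.gtA || decide (x < n + 1)) := by
        rw [Bool.or_assoc, ← Bool.decide_or]; congr 2; apply propext; omega
      have hb : (v.gtB || decide (y < 1) || decide (y - 1 < n)) =
          (v.gtB || decide (y < n + 1)) := by
        rw [Bool.or_assoc, ← Bool.decide_or]; congr 2; apply propext; omega
      simp only [ha, hb]
    · rw [show x - 1 - n = x - (n + 1) by omega, show y - 1 - n = y - (n + 1) by omega,
        show x₂ + min x 1 + min (x - 1) n = x₂ + min x (n + 1) by omega,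
        show y₂ + min y 1 + min (y - 1) n = y₂ + min y (n + 1) by omega,
        Reduction.replicate_append_cons]
      simp only [P', update_idem]
    · omega

theorem runs_compare (i : Fin N) (n : ℕ) (l : List Bool) (hP : P i = encodeUnary n ++ l) :
    Runs (compare i) v (work w e x 0 y 0 s P)
      { v with sym := none, gtA := decide (x < n), ltA := decide (n < x), gtB := decide (y < n),
               ltB := decide (n < y) }
      (work w e x 0 y 0 ((encodeUnary n).reverse ++ s) (update P i l)) (3 * n + 3) := by
  have h₁ := (runs_scanNumber w e x 0 y 0 s P { v with gtA := false, gtB := false } i n l hP).cast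
    (v'' := { v with sym := some false, gtA := decide (x < n), gtB := decide (y < n) })
    (S'' := work w e (x - n) (min x n) (y - n) (min y n) (List.replicate n true ++ s)
      (update P i l)) (by simp) (by simp) le_rfl
  have h₂ (v : Reg N) : Runs (push scan fun _ : Reg N => false) v
      (work w e (x - n) (min x n) (y - n) (min y n) (List.replicate n true ++ s) (update P i l)) v
      (work w e (x - n) (min x n) (y - n) (min y n) ((encodeUnary n).reverse ++ s) (update P i l))
      0 :=
    (runs_push (Γ := Alph N) scan _).cast rfl
      (by simp [work, stk, Reduction.reverse_encodeUnary]) le_rfl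
  have h₃ (v : Reg N) : Runs (shift a₂ a) v
      (work w e (x - n) (min x n) (y - n) (min y n) ((encodeUnary n).reverse ++ s) (update P i l))
      { v with sym := none }
      (work w e x 0 (y - n) (min y n) ((encodeUnary n).reverse ++ s) (update P i l)) (n + 1) := by
    refine (runs_shift (by simp) rfl rfl v _).cast rfl ?_ ?_
    · simp [work, stk, show min x n + (x - n) = x by omega]
    · simp [stk]
  have h₄ (v : Reg N) : Runs (shift b₂ b) v
      (work w e x 0 (y - n) (min y n) ((encodeUnary n).reverse ++ s) (update P i l))
      { v with sym := none }
      (work w e x 0 y 0 ((encodeUnary n).reverse ++ s) (update P i l)) (n + 1) := by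
    refine (runs_shift (by simp) rfl rfl v _).cast rfl ?_ ?_
    · simp [work, stk, show min y n + (y - n) = y by omega]
    · simp [stk]
  have hd (k : ℕ) : (List.replicate (k - n) true).head?.isSome = decide (n < k) := by
    cases hk : k - n with
    | zero => simp; omega
    | succ m => simp [List.replicate_succ]; omega
  refine ((runs_load _).seq (h₁.seq ((h₂ _).seq ((runs_peek _ _).seq ((runs_peek _ _).seq
    ((h₃ _).seq (h₄ _))))))).cast ?_ rfl (by omega)
  simp [stk, hd]

end

end Verifier

/-! ### Checking the edges one by one -/

namespace Verifier

open Stack Prog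

variable {N : ℕ}

instance {p : Prop} [Decidable p] (e f : ℕ × ℕ) : Decidable (Conflict p e f) := by
  unfold Conflict
  infer_instance

/-- Two edges cannot both be on page `i`. -/
def clash (s : ℕ) (i : Fin N) (e f : ℕ × ℕ) : Bool :=
  decide (Conflict (i.val < s) e f ∨ Conflict (i.val < s) f e)

/-- The conflict of the current edge with an edge on page `i`, in terms of the comparisons of its
two endpoints. -/
def clashReg (s : ℕ) (i : Fin N) (v : Reg N) : Bool :=
  if i.val < s then (v.gtA₀ && v.ltB₀ && v.gtB) || (v.ltA₀ && v.gtA && v.ltB)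
  else (v.gtA₀ && v.ltB) || (v.ltA₀ && v.gtB)

theorem clashReg_eq (s : ℕ) (i : Fin N) (x y : ℕ) (f : ℕ × ℕ) (v : Reg N)
    (h₁ : v.gtA = decide (x < f.2)) (h₂ : v.gtB = decide (y < f.2)) (h₃ : v.ltB = decide (f.2 < y))
    (h₄ : v.gtA₀ = decide (x < f.1)) (h₅ : v.ltA₀ = decide (f.1 < x))
    (h₆ : v.ltB₀ = decide (f.1 < y)) : clashReg s i v = clash s i (x, y) f := by
  rw [Bool.eq_iff_iff]
  simp only [clashReg, clash, Conflict, h₁, h₂, h₃, h₄, h₅, h₆]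
  split_ifs with hs <;> simp only [hs, Bool.or_eq_true, Bool.and_eq_true, decide_eq_true_eq,
    true_and, false_and, not_true_eq_false, not_false_eq_true, false_or, or_false]
  all_goals omega

/-- The string by which an edge is stored on its page; the leading symbol tells that there is
another edge. -/
def encodeEntry (e : ℕ × ℕ) : List Bool := false :: encodePair e

/-- Compare the current edge with all edges on page `i`, moving these to the scanned part. -/
def scanPage (s : ℕ) (i : Fin N) : Frag N :=
  loop (pop (page i) fun v x => { v with sym := x }) (fun v => v.sym.isSome) <|
    seq (push scan fun _ => false) <| seq (compare i) <|
    seq (load fun v => { v with gtA₀ := v.gtA, ltA₀ := v.ltA, ltB₀ := v.ltB }) <|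
    seq (compare i) (load fun v => { v with ok := v.ok && !clashReg s i v })

/-- Check the current edge against page `i`, and put it there. -/
def addEdge (s : ℕ) (i : Fin N) : Frag N :=
  seq (scanPage s i) <| seq (shift scan (page i)) <|
  seq (push (page i) fun _ => false) <| seq (shift b (page i)) <|
  seq (push (page i) fun _ => false) <| seq (shift a (page i)) (push (page i) fun _ => false)

/-- Handle the current edge on the page that the internal state holds, if that is in the list. -/
def addEdgeAny (s : ℕ) : List (Fin N) → Frag N
  | [] => skip
  | i :: l => branch (fun v => v.pg == i) (addEdge s i) (addEdgeAny s l)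

@[simp] theorem map_cast_bool (h : Bool = Bool) (l : List Bool) : l.map (cast h) = l :=
  List.map_id l

section

variable (w : List Sym) (e : List Bool) (x y : ℕ)

theorem runs_scanPage (s : ℕ) (i : Fin N) (l : List (ℕ × ℕ)) (sc : List Bool)
    (P : Fin N → List Bool) (hP : P i = l.flatMap encodeEntry) (v : Reg N) :
    ∃ v' : Reg N, v'.ok = (v.ok && l.all fun f => !clash s i (x, y) f) ∧
      Runs (scanPage s i) v (work w e x 0 y 0 sc P) v'
        (work w e x 0 y 0 ((l.flatMap encodeEntry).reverse ++ sc) (update P i []))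
        (7 * (l.flatMap encodeEntry).length + 1) := by
  induction l generalizing sc P v with
  | nil =>
    have h := runs_pop (Γ := Alph N) (v := v) (S := work w e x 0 y 0 sc P) (page i)
      fun (v : Reg N) x => { v with sym := x }
    have e₁ : work w e x 0 y 0 sc P (page i) = [] := hP
    rw [e₁] at h
    exact ⟨_, by simp, (h.loop_exit rfl).cast rfl (by simp [work]) (by simp)⟩
  | cons f l ih =>
    have h := runs_pop (Γ := Alph N) (v := v) (S := work w e x 0 y 0 sc P) (page i)
      fun (v : Reg N) x => { v with sym := x }
    have e₁ : work w e x 0 y 0 sc P (page i) =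
      false :: (encodeUnary f.1 ++ (encodeUnary f.2 ++ l.flatMap encodeEntry)) := by
      change P i = _
      rw [hP]
      simp [encodeEntry, encodePair]
    rw [e₁] at h
    let P₁ := update P i (encodeUnary f.1 ++ (encodeUnary f.2 ++ l.flatMap encodeEntry))
    let P₂ := update P₁ i (encodeUnary f.2 ++ l.flatMap encodeEntry)
    let P₃ := update P₂ i (l.flatMap encodeEntry)
    have h₀ := h.cast (v'' := { v with sym := some false }) (S'' := work w e x 0 y 0 sc P₁)
      (t' := 0) (by simp) (by simp [work, P₁]) le_rfl
    have h₁ : Runs (push scan fun _ : Reg N => false) { v with sym := some false }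
        (work w e x 0 y 0 sc P₁) { v with sym := some false }
        (work w e x 0 y 0 (false :: sc) P₁) 0 :=
      (runs_push (Γ := Alph N) scan _).cast rfl (by simp [work, stk]) le_rfl
    have h₂ (v : Reg N) := runs_compare w e x y (false :: sc) P₁ v i f.1
      (encodeUnary f.2 ++ l.flatMap encodeEntry) (by simp [P₁])
    have h₃ (v : Reg N) := runs_compare w e x y ((encodeUnary f.1).reverse ++ (false :: sc)) P₂ v
      i f.2 (l.flatMap encodeEntry) (by simp [P₂])
    obtain ⟨v', hv', h₄⟩ := ih ((encodeUnary f.2).reverse ++ ((encodeUnary f.1).reverse ++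
      (false :: sc))) P₃ (by simp [P₃]) ⟨none, v.pg, x < f.2, f.2 < x, y < f.2, f.2 < y,
        x < f.1, f.1 < x, f.1 < y, v.ok && !clash s i (x, y) f⟩
    refine ⟨v', ?_, (h₀.loop_step rfl (h₁.seq ((h₂ _).seq ((runs_load _).seq ((h₃ _).seq
      ((runs_load _).cast ?_ rfl le_rfl))))) h₄).cast rfl ?_ ?_⟩
    · rw [hv', List.all_cons, Bool.and_assoc]
    · rw [clashReg_eq s i x y f] <;> rfl
    · simp [P₁, P₂, P₃, encodeEntry, encodePair]
    · simp only [List.flatMap_cons, List.length_append, encodeEntry, encodePair, List.length_cons,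
        Reduction.length_encodeUnary]
      omega

theorem runs_addEdge (s : ℕ) (i : Fin N) (l : List (ℕ × ℕ)) (P : Fin N → List Bool)
    (hP : P i = l.flatMap encodeEntry) (v : Reg N) :
    ∃ v' : Reg N, v'.ok = (v.ok && l.all fun f => !clash s i (x, y) f) ∧
      Runs (addEdge s i) v (work w e x 0 y 0 [] P) v'
        (work w e 0 0 0 0 [] (update P i (((x, y) :: l).flatMap encodeEntry)))
        (8 * (l.flatMap encodeEntry).length + x + y + 4) := by
  obtain ⟨v', hv', h⟩ := runs_scanPage w e x y s i l [] P hP v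
  let m := l.flatMap encodeEntry
  let Q (l : List Bool) := update P i l
  have h₁ (v : Reg N) : Runs (shift scan (page i)) v (work w e x 0 y 0 (m.reverse ++ []) (Q []))
      { v with sym := none } (work w e x 0 y 0 [] (Q m)) (m.length + 1) :=
    (runs_shift (by simp) rfl rfl v _).cast rfl (by simp [work, stk, Q]) (by simp [stk])
  have h₂ (v : Reg N) (x y : ℕ) (l : List Bool) : Runs (push (page i) fun _ => false) v
      (work w e x 0 y 0 [] (Q l)) v (work w e x 0 y 0 [] (Q (false :: l))) 0 :=
    (runs_push (Γ := Alph N) (page i) _).cast rfl (by simp [work, stk, Q]) le_rfl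
  have h₃ (v : Reg N) (l : List Bool) : Runs (shift b (page i)) v
      (work w e x 0 y 0 [] (Q l)) { v with sym := none }
      (work w e x 0 0 0 [] (Q (List.replicate y true ++ l))) (y + 1) :=
    (runs_shift (by simp) rfl rfl v _).cast rfl (by simp [work, stk, Q]) (by simp [stk])
  have h₄ (v : Reg N) (l : List Bool) : Runs (shift a (page i)) v
      (work w e x 0 0 0 [] (Q l)) { v with sym := none }
      (work w e 0 0 0 0 [] (Q (List.replicate x true ++ l))) (x + 1) :=
    (runs_shift (by simp) rfl rfl v _).cast rfl (by simp [work, stk, Q]) (by simp [stk])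
  refine ⟨{ v' with sym := none }, hv', (h.seq ((h₁ _).seq ((h₂ _ _ _ _).seq ((h₃ _ _).seq
    ((h₂ _ _ _ _).seq ((h₄ _ _).seq (h₂ _ _ _ _))))))).cast rfl ?_ ?_⟩
  · simp [Q, m, encodeEntry, encodePair, encodeUnary]
  · have : m.length = (l.flatMap encodeEntry).length := rfl
    omega

theorem runs_addEdgeAny (s : ℕ) (L : List (Fin N)) (l : List (ℕ × ℕ)) (P : Fin N → List Bool)
    (v : Reg N) (hL : v.pg ∈ L) (hP : P v.pg = l.flatMap encodeEntry) :
    ∃ v' : Reg N, v'.ok = (v.ok && l.all fun f => !clash s v.pg (x, y) f) ∧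
      Runs (addEdgeAny s L) v (work w e x 0 y 0 [] P) v'
        (work w e 0 0 0 0 [] (update P v.pg (((x, y) :: l).flatMap encodeEntry)))
        (8 * (l.flatMap encodeEntry).length + x + y + 4) := by
  induction L with
  | nil => cases hL
  | cons i L ih =>
    by_cases hi : v.pg = i
    · subst hi
      obtain ⟨v', hv', h⟩ := runs_addEdge w e x y s v.pg l P hP v
      exact ⟨v', hv', h.branch_true (by simp)⟩
    · obtain ⟨v', hv', h⟩ := ih ((List.mem_cons.1 hL).resolve_left hi)
      exact ⟨v', hv', h.branch_false (by simpa using hi)⟩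

end

/-- Read a number from the string of edges. -/
def readNumber (k : Stack N) (h : Alph N k = Bool := by rfl) : Frag N :=
  loop (pop edges fun v x => { v with sym := x }) (fun v => v.sym == some true)
    (push k fun _ => cast h.symm true)

theorem runs_readNumber {k : Stack N} (hk : k ≠ edges) (h : Alph N k = Bool) (n : ℕ) (l : List Bool)
    (v : Reg N) (S : ∀ k, List (Alph N k)) (hS : S edges = encodeUnary n ++ l) :
    Runs (readNumber k h) v S { v with sym := some false }
      (update (update S edges l) k (List.replicate n (cast h.symm true) ++ S k)) (n + 1) := by
  induction n generalizing v S with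
  | zero =>
    have h₁ := runs_pop (Γ := Alph N) (v := v) (S := S) edges fun (v : Reg N) x =>
      { v with sym := x }
    rw [hS] at h₁
    refine (h₁.loop_exit rfl).cast rfl ?_ le_rfl
    simp only [encodeUnary, List.replicate_zero, List.nil_append, List.singleton_append,
      List.tail_cons]
    rw [← update_of_ne (β := fun k => List (Alph N k)) hk (v := l) (f := S), update_eq_self]
  | succ n ih =>
    have h₁ := runs_pop (Γ := Alph N) (v := v) (S := S) edges fun (v : Reg N) x =>
      { v with sym := x }
    rw [hS] at h₁
    refine (h₁.loop_step rfl (runs_push k _) (ih _ _ ?_)).cast rfl ?_ (by omega)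
    · rw [update_of_ne hk.symm, update_self]
      simp [encodeUnary, List.replicate_succ]
    · funext j
      by_cases h₁ : j = k
      · subst h₁
        simp only [update_self, update_of_ne hk]
        rw [List.replicate_succ', List.append_assoc, List.singleton_append]
      · by_cases h₂ : j = edges
        · subst h₂; simp [h₁]
        · simp [h₁, h₂]

variable [NeZero N]

/-- Read a page number from the certificate: the number of ones before the first zero or the end,
modulo the number of pages. -/
def takePage : Fin N → List Bool → Fin N × List Bool
  | k, [] => (k, [])
  | k, false :: w => (k, w)
  | k, true :: w => takePage (k + 1) w

theorem length_takePage_le (k : Fin N) (w : List Bool) :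
    (takePage k w).2.length ≤ w.length := by
  induction w generalizing k with
  | nil => simp [takePage]
  | cons b w ih =>
    cases b
    · simp [takePage]
    · exact (ih (k + 1)).trans (by simp)

/-- The condition that the verifier checks: the edges of `E` are put on the pages given by `w` one
after the other, and no edge is in conflict with one put on its page before; `Q` are the edges on
the pages so far. -/
def check (s : ℕ) : List (ℕ × ℕ) → List Bool → (Fin N → List (ℕ × ℕ)) → Bool
  | [], _, _ => true
  | e :: E, w, Q =>
    ((Q (takePage (0 : Fin N) w).1).all fun f => !clash s (takePage (0 : Fin N) w).1 e f) &&
      check s E (takePage (0 : Fin N) w).2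
        (update Q (takePage (0 : Fin N) w).1 (e :: Q (takePage (0 : Fin N) w).1))

/-- Read a page number from the certificate. -/
def readPage : Frag N :=
  seq (load fun v => { v with pg := (0 : Fin N) }) <|
  loop (pop inp fun v x => { v with sym := some (decide (x = some (some (Sum.inr true)))) })
    (fun v => v.sym == some true) (load fun v => { v with pg := v.pg + 1 })

/-- The certificate as a part of the input. -/
abbrev certSym (w : List Bool) : List Sym := w.map fun b => some (Sum.inr b)

theorem runs_readPage (w : List Bool) (e : List Bool) (x x₂ y y₂ : ℕ) (sc : List Bool)
    (P : Fin N → List Bool) (v : Reg N) :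
    Runs readPage v (work (certSym w) e x x₂ y y₂ sc P)
      { v with sym := some false, pg := (takePage (0 : Fin N) w).1 }
      (work (certSym (takePage (0 : Fin N) w).2) e x x₂ y y₂ sc P) (w.length + 1) := by
  have h (k : Fin N) (v : Reg N) : Runs
      (loop (pop inp fun v x => { v with sym := some (decide (x = some (some (Sum.inr true)))) })
        (fun v => v.sym == some true) (load fun v => { v with pg := v.pg + 1 })) { v with pg := k }
      (work (certSym w) e x x₂ y y₂ sc P) { v with sym := some false, pg := (takePage k w).1 }
      (work (certSym (takePage k w).2) e x x₂ y y₂ sc P) (w.length + 1) := by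
    induction w generalizing k v with
    | nil =>
      have h := runs_pop (Γ := Alph N) (v := { v with pg := k })
        (S := work (certSym []) e x x₂ y y₂ sc P) inp
        fun (v : Reg N) x => { v with sym := some (decide (x = some (some (Sum.inr true)))) }
      exact (h.loop_exit rfl).cast rfl (by simp [work, stk, takePage]) (by simp)
    | cons c w ih =>
      have h := runs_pop (Γ := Alph N) (v := { v with pg := k })
        (S := work (certSym (c :: w)) e x x₂ y y₂ sc P) inp
        fun (v : Reg N) x => { v with sym := some (decide (x = some (some (Sum.inr true)))) }
      have e₁ : update (work (certSym (c :: w)) e x x₂ y y₂ sc P) inp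
          (work (certSym (c :: w)) e x x₂ y y₂ sc P inp).tail =
          work (certSym w) e x x₂ y y₂ sc P := by simp [work, stk]
      rw [e₁] at h
      cases c
      · exact (h.loop_exit rfl).cast rfl rfl (by simp)
      · exact (h.loop_step rfl (runs_load _) (ih (k + 1) { v with sym := some true })).cast rfl rfl
          (by simp)
  exact ((runs_load _).seq (h 0 v)).mono (by omega)

/-- Handle all edges. -/
def handleEdges (s : ℕ) : Frag N :=
  loop (readNumber a) (fun v => v.sym.isSome)
    (seq (readNumber b) (seq readPage (addEdgeAny s (List.finRange N))))

theorem runs_handleEdges (s : ℕ) (B : ℕ) (E : List (ℕ × ℕ)) (w : List Bool)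
    (Q : Fin N → List (ℕ × ℕ)) (v : Reg N) (hw : w.length ≤ B)
    (hQ : ∀ i, ((Q i).flatMap encodeEntry).length + (E.flatMap encodeEntry).length ≤ B) :
    ∃ (v' : Reg N) (W : List Sym) (P : Fin N → List Bool), v'.ok = (v.ok && check s E w Q) ∧
      W.length ≤ B ∧ (∀ i, (P i).length ≤ B) ∧
      Runs (handleEdges s) v (work (certSym w) (E.flatMap encodePair) 0 0 0 0 []
        fun i => (Q i).flatMap encodeEntry) v' (work W [] 0 0 0 0 [] P)
        (E.length * (11 * B + 8) + 2) := by
  induction E generalizing w Q v with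
  | nil =>
    have h := runs_pop (Γ := Alph N) (v := v) (S := work (certSym w) [] 0 0 0 0 []
        fun i => (Q i).flatMap encodeEntry) edges fun (v : Reg N) x => { v with sym := x }
    exact ⟨{ v with sym := none }, certSym w, fun i => (Q i).flatMap encodeEntry, by simp [check],
      by simpa using hw, fun i => by simpa using hQ i, ((h.loop_exit rfl).loop_exit rfl).cast rfl
        (by simp [work, stk]) (by omega)⟩
  | cons e E ih =>
    let P : Fin N → List Bool := fun i => (Q i).flatMap encodeEntry
    have h₁ : Runs (readNumber a) v (work (certSym w) ((e :: E).flatMap encodePair) 0 0 0 0 [] P)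
        { v with sym := some false }
        (work (certSym w) (encodeUnary e.2 ++ E.flatMap encodePair) e.1 0 0 0 [] P) (e.1 + 1) :=
      (runs_readNumber (by simp) rfl e.1 (encodeUnary e.2 ++ E.flatMap encodePair) v _
        (by simp [work, stk, encodePair])).cast rfl (by simp [work, stk]) le_rfl
    have h₂ (v : Reg N) : Runs (readNumber b) v
        (work (certSym w) (encodeUnary e.2 ++ E.flatMap encodePair) e.1 0 0 0 [] P)
        { v with sym := some false }
        (work (certSym w) (E.flatMap encodePair) e.1 0 e.2 0 [] P) (e.2 + 1) :=
      (runs_readNumber (by simp) rfl e.2 (E.flatMap encodePair) v _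
        (by simp [work, stk])).cast rfl (by simp [work, stk]) le_rfl
    have h₃ := runs_readPage w (E.flatMap encodePair) e.1 0 e.2 0 [] P
    obtain ⟨v₁, hv₁, h₄⟩ := runs_addEdgeAny (certSym (takePage (0 : Fin N) w).2)
      (E.flatMap encodePair) e.1 e.2 s (List.finRange N) (Q (takePage (0 : Fin N) w).1) P
      { v with sym := some false, pg := (takePage (0 : Fin N) w).1 } (List.mem_finRange _) rfl
    let Q' := update Q (takePage (0 : Fin N) w).1 (e :: Q (takePage (0 : Fin N) w).1)
    have hQ' : update P (takePage (0 : Fin N) w).1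
        ((e :: Q (takePage (0 : Fin N) w).1).flatMap encodeEntry) =
          fun i => (Q' i).flatMap encodeEntry := by
      funext j
      by_cases hj : j = (takePage (0 : Fin N) w).1
      · subst hj; simp [Q']
      · simp [Q', P, hj]
    have len (i : Fin N) := hQ i
    simp only [List.flatMap_cons, List.length_append] at len
    obtain ⟨v', W, P', hv', hW, hP', h₅⟩ := ih (takePage (0 : Fin N) w).2 Q' v₁
      ((length_takePage_le _ _).trans hw) fun i => by
        by_cases hi : i = (takePage (0 : Fin N) w).1
        · subst hi
          have := len (takePage (0 : Fin N) w).1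
          simp only [Q', update_self, List.flatMap_cons, List.length_append]
          omega
        · have := len i
          simp only [Q', update_of_ne hi]
          omega
    refine ⟨v', W, P', ?_, hW, hP', (h₁.loop_step rfl ((h₂ _).seq ((h₃ _).seq
      (h₄.cast rfl (congrArg _ hQ') le_rfl))) h₅).cast rfl rfl ?_⟩
    · rw [hv', hv₁, check, Bool.and_assoc]
    · have l₁ := len (takePage (0 : Fin N) w).1
      have l₂ : (encodeEntry e).length = e.1 + e.2 + 3 := by
        simp [encodeEntry, encodePair, encodeUnary]; omega
      rw [List.length_cons, Nat.add_mul]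
      omega

end Verifier

/-! ### Membership in NP -/

namespace Verifier

open Stack Prog

variable {N : ℕ}

/-- A part of the instance as a part of the input. -/
abbrev instSym (l : List Bool) : List Sym := l.map fun c => some (Sum.inl c)

/-- Skip the number of vertices. -/
def skipNumber : Frag N :=
  loop (pop inp fun v x => { v with sym := some (decide (x = some (some (Sum.inl true)))) })
    (fun v => v.sym == some true) skip

/-- The bit of an input symbol that belongs to the instance. -/
def instBit : Option Sym → Option Bool
  | some (some (Sum.inl c)) => some c
  | _ => none

/-- Move the string of edges from the input to a stack of its own, reversing it, and remove the
separator. -/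
def splitInput : Frag N :=
  loop (pop inp fun v x => { v with sym := instBit x }) (fun v => v.sym.isSome)
    (push rev fun v => v.sym.getD false)

/-- Empty a stack. -/
def clear (k : Stack N) : Frag N :=
  loop (pop k fun v x => { v with sym := x.map fun _ => true }) (fun v => v.sym.isSome) skip

/-- Empty the pages of a list. -/
def clearPages : List (Fin N) → Frag N
  | [] => skip
  | i :: l => seq (clear (page i)) (clearPages l)

theorem runs_skipNumber (n : ℕ) (w : List Sym) (v : Reg N) :
    Runs skipNumber v (work (instSym (encodeUnary n) ++ w) [] 0 0 0 0 [] fun _ => [])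
      { v with sym := some false } (work w [] 0 0 0 0 [] fun _ => []) (n + 1) := by
  have h (n : ℕ) (v : Reg N) := runs_pop (Γ := Alph N) (v := v)
    (S := work (instSym (encodeUnary n) ++ w) [] 0 0 0 0 [] fun _ => []) inp
    fun (v : Reg N) x => { v with sym := some (decide (x = some (some (Sum.inl true)))) }
  induction n generalizing v with
  | zero => exact ((h 0 v).loop_exit rfl).cast rfl (by simp [work, stk, encodeUnary]) le_rfl
  | succ n ih =>
    refine ((h (n + 1) v).loop_step rfl (runs_skip.cast rfl ?_ le_rfl)
      (ih { v with sym := some true })).cast rfl rfl (by omega)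
    simp [work, stk, encodeUnary, List.replicate_succ]

theorem runs_splitInput (l r : List Bool) (w : List Sym) (v : Reg N) :
    Runs splitInput v (stk (instSym l ++ none :: w) r [] [] [] [] [] [] (fun _ => []) [])
      { v with sym := none } (stk w (l.reverse ++ r) [] [] [] [] [] [] (fun _ => []) [])
      (l.length + 1) := by
  induction l generalizing r v with
  | nil =>
    have h := runs_pop (Γ := Alph N) (v := v) (S := stk (instSym [] ++ none :: w) r [] [] [] [] []
      [] (fun _ => []) []) inp fun (v : Reg N) x => { v with sym := instBit x }
    exact (h.loop_exit rfl).cast rfl (by simp [stk]) le_rfl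
  | cons c l ih =>
    have h := runs_pop (Γ := Alph N) (v := v) (S := stk (instSym (c :: l) ++ none :: w) r [] [] []
      [] [] [] (fun _ => []) []) inp fun (v : Reg N) x => { v with sym := instBit x }
    refine (h.loop_step rfl ((runs_push (Γ := Alph N) rev _).cast rfl ?_ le_rfl)
      (ih (c :: r) { v with sym := some c })).cast rfl (by simp) (by simp)
    simp [stk, instBit]

theorem runs_clear (k : Stack N) (v : Reg N) (S : ∀ k, List (Alph N k)) :
    Runs (clear k) v S { v with sym := none } (update S k []) ((S k).length + 1) := by
  generalize hl : S k = l
  induction l generalizing v S with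
  | nil =>
    have h := runs_pop (v := v) (S := S) k
      fun (v : Reg N) x => { v with sym := x.map fun _ => true }
    rw [hl] at h
    exact h.loop_exit rfl
  | cons c l ih =>
    have h := runs_pop (v := v) (S := S) k
      fun (v : Reg N) x => { v with sym := x.map fun _ => true }
    rw [hl] at h
    exact (h.loop_step rfl runs_skip (ih { v with sym := some true } (update S k l)
      (by simp))).cast rfl (by simp) (by simp)

theorem runs_clearPages (L : List (Fin N)) {B : ℕ} (P : Fin N → List Bool)
    (hP : ∀ i, (P i).length ≤ B) (v : Reg N) :
    ∃ v' : Reg N, v'.ok = v.ok ∧ Runs (clearPages L) v (work [] [] 0 0 0 0 [] P) v'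
      (work [] [] 0 0 0 0 [] fun i => if i ∈ L then [] else P i) (L.length * (B + 1)) := by
  induction L generalizing P v with
  | nil => exact ⟨v, rfl, runs_skip.cast rfl (by simp) (by simp)⟩
  | cons i L ih =>
    obtain ⟨v', hv', h⟩ := ih (update P i []) (fun j => by
      by_cases hj : j = i
      · subst hj; simp
      · rw [update_of_ne hj]; exact hP j) { v with sym := none }
    have h₁ : Runs (clear (page i)) v (work [] [] 0 0 0 0 [] P) { v with sym := none }
        (work [] [] 0 0 0 0 [] (update P i [])) (B + 1) :=
      (runs_clear _ _ _).cast rfl (by simp [work]) (Nat.succ_le_succ (hP i))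
    refine ⟨v', hv', (h₁.seq h).cast rfl ?_ ?_⟩
    · congr 1
      funext j
      by_cases hj : j = i <;> by_cases hj' : j ∈ L <;> simp [hj, hj']
    · rw [List.length_cons, Nat.add_mul]; omega

theorem length_encodeEntries_le (E : List (ℕ × ℕ)) :
    (E.flatMap encodeEntry).length ≤ 2 * (E.flatMap encodePair).length ∧
      E.length ≤ (E.flatMap encodePair).length := by
  induction E with
  | nil => simp
  | cons e E ih =>
    simp only [List.flatMap_cons, List.length_append, encodeEntry, encodePair, List.length_cons,
      Reduction.length_encodeUnary] at ih ⊢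
    omega

theorem clash_comm (s : ℕ) (i : Fin N) (e f : ℕ × ℕ) : clash s i e f = clash s i f e := by
  simp only [clash, or_comm]

theorem clash_self (s : ℕ) (i : Fin N) (e : ℕ × ℕ) : clash s i e e = false := by
  simp [clash, Conflict]

variable [NeZero N]

/-- The initial internal state. -/
def init : Reg N := ⟨none, 0, false, false, false, false, false, false, false, true⟩

/-- The verifier's program: unpack the input, handle the edges, clean up, write the answer. -/
def prog (s : ℕ) : Frag N :=
  seq skipNumber <| seq splitInput <| seq (shift rev edges) <| seq (handleEdges s) <|
  seq (clear inp) <| seq (clearPages (List.finRange N)) <| seq (push out fun v => v.ok) <|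
  load fun _ => init

theorem runs_prog (s n : ℕ) (E : List (ℕ × ℕ)) (w : List Bool) {m : ℕ}
    (hm : n + 1 + (E.flatMap encodePair).length + 1 + w.length ≤ m) :
    Runs (prog s) (init (N := N)) (update (fun _ => []) inp
      (instSym (encodeUnary n ++ E.flatMap encodePair) ++ none :: certSym w)) init
      (update (fun _ => []) out [check (N := N) s E w fun _ => []])
      (3 * m + (m * (22 * m + 8) + 2) + (2 * m + 1) + N * (2 * m + 1)) := by
  have e₀ : (fun _ => [] : ∀ k, List (Alph N k)) =
      stk [] [] [] [] [] [] [] [] (fun _ => []) [] := by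
    funext k; cases k <;> rfl
  rw [e₀, update_inp, update_out]
  let l := E.flatMap encodePair
  have hl := length_encodeEntries_le E
  have h₁ := runs_skipNumber n (instSym l ++ none :: certSym w) (init (N := N))
  have h₂ (v : Reg N) := runs_splitInput l [] (certSym w) v
  have h₃ (v : Reg N) : Runs (shift rev edges) v
      (stk (certSym w) (l.reverse ++ []) [] [] [] [] [] [] (fun _ => []) []) { v with sym := none }
      (work (certSym w) l 0 0 0 0 [] fun _ => []) (l.length + 1) :=
    (runs_shift (by simp) rfl rfl v _).cast rfl (by simp [work, stk]) (by simp [stk])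
  obtain ⟨v', W, P, hv', hW, hP, h₄⟩ := runs_handleEdges (N := N) s (2 * m) E w (fun _ => [])
    { (init (N := N)) with sym := none } (by omega) fun i => by
      simp only [List.flatMap_nil, List.length_nil]; omega
  have h₅ : Runs (clear inp) v' (work W [] 0 0 0 0 [] P) { v' with sym := none }
      (work [] [] 0 0 0 0 [] P) (2 * m + 1) :=
    (runs_clear _ _ _).cast rfl (by simp [work]) (Nat.succ_le_succ hW)
  obtain ⟨v₂, hv₂, h₆⟩ := runs_clearPages (List.finRange N) P hP { v' with sym := none }
  have h₇ := runs_push (Γ := Alph N) (v := v₂) (S := work [] [] 0 0 0 0 [] fun i =>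
    if i ∈ List.finRange N then [] else P i) out fun v : Reg N => v.ok
  have hS : update (work [] [] 0 0 0 0 [] fun i => if i ∈ List.finRange N then [] else P i) out
      (v₂.ok :: work [] [] 0 0 0 0 [] (fun i => if i ∈ List.finRange N then [] else P i) out) =
      stk [] [] [] [] [] [] [] [] (fun _ => []) [check (N := N) s E w fun _ => []] := by
    rw [hv₂, show ({ v' with sym := none } : Reg N).ok = v'.ok from rfl, hv']
    simp [work, stk, init]
  have ht : E.length * (11 * (2 * m) + 8) ≤ m * (22 * m + 8) :=
    Nat.mul_le_mul (by omega) (by omega)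
  rw [List.length_finRange] at h₆
  have h := h₁.seq ((h₂ _).seq ((h₃ _).seq (h₄.seq (h₅.seq (h₆.seq
    (h₇.seq (runs_load fun _ => init)))))))
  have hll : l.length = (E.flatMap encodePair).length := rfl
  have e : instSym (encodeUnary n ++ l) ++ none :: certSym w =
      instSym (encodeUnary n) ++ (instSym l ++ none :: certSym w) := by
    simp [instSym]
  rw [e]
  exact h.cast rfl hS (by omega)

theorem exists_page_of_check (s : ℕ) {E : List (ℕ × ℕ)} (hE : E.Nodup) (w : List Bool)
    (Q : Fin N → List (ℕ × ℕ)) (h : check s E w Q = true) :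
    ∃ page : ℕ × ℕ → Fin N,
      (∀ e ∈ E, ∀ f ∈ E, page e = page f → clash s (page e) e f = false) ∧
      ∀ e ∈ E, ∀ f ∈ Q (page e), clash s (page e) e f = false := by
  induction E generalizing w Q with
  | nil => exact ⟨fun _ => 0, by simp, by simp⟩
  | cons e E ih =>
    rw [check, Bool.and_eq_true, List.all_eq_true] at h
    obtain ⟨h₁, h₂⟩ := h
    rw [List.nodup_cons] at hE
    obtain ⟨page, h₃, h₄⟩ := ih hE.2 _ _ h₂
    let k := (takePage (0 : Fin N) w).1
    have hk : ∀ f ∈ Q k, clash s k e f = false := fun f hf => by simpa using h₁ f hf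
    have hne {f : ℕ × ℕ} (hf : f ∈ E) : f ≠ e := fun h => hE.1 (h ▸ hf)
    have hpage {f : ℕ × ℕ} (hf : f ∈ E) : update page e k f = page f := update_of_ne (hne hf) _ _
    have he {f : ℕ × ℕ} (hf : f ∈ E) (hfk : page f = k) : clash s k f e = false := by
      have := h₄ f hf e
      rw [hfk, update_self] at this
      exact this List.mem_cons_self
    refine ⟨update page e k, fun f hf g hg hfg => ?_, fun f hf g hg => ?_⟩
    · rcases List.mem_cons.1 hf with hf' | hf' <;> rcases List.mem_cons.1 hg with hg' | hg'
      · rw [hf', hg']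
        exact clash_self _ _ _
      · rw [hf', update_self, hpage hg'] at hfg
        rw [hf', update_self, clash_comm]
        exact he hg' hfg.symm
      · rw [hg', update_self, hpage hf'] at hfg
        rw [hpage hf', hfg, hg']
        exact he hf' hfg
      · rw [hpage hf', hpage hg'] at hfg
        rw [hpage hf']
        exact h₃ f hf' g hg' hfg
    · rcases List.mem_cons.1 hf with hf' | hf'
      · rw [hf', update_self] at hg ⊢
        exact hk g hg
      · rw [hpage hf'] at hg ⊢
        refine h₄ f hf' g ?_
        by_cases hfk : page f = k
        · rw [hfk] at hg ⊢
          rw [update_self]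
          exact List.mem_cons_of_mem _ hg
        · rwa [update_of_ne hfk]

theorem takePage_encodeUnary (p : ℕ) (k : Fin N) (w : List Bool) :
    takePage k (encodeUnary p ++ w) = (Fin.ofNat N (k.val + p), w) := by
  induction p generalizing k with
  | zero => simp [encodeUnary, takePage]
  | succ p ih =>
    change takePage (k + 1) (encodeUnary p ++ w) = _
    rw [ih]
    congr 1
    ext
    simp [Fin.val_add, Nat.add_assoc, Nat.add_comm 1 p]

theorem check_of_page (s : ℕ) (E : List (ℕ × ℕ)) (page : ℕ × ℕ → Fin N)
    (Q : Fin N → List (ℕ × ℕ))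
    (h : ∀ e ∈ E, ∀ f ∈ E, page e = page f → clash s (page e) e f = false)
    (hQ : ∀ e ∈ E, ∀ f ∈ Q (page e), clash s (page e) e f = false) :
    check s E (E.flatMap fun e => encodeUnary (page e).val) Q = true := by
  induction E generalizing Q with
  | nil => rfl
  | cons e E ih =>
    have ht : takePage (0 : Fin N) ((e :: E).flatMap fun e => encodeUnary (page e).val) =
        (page e, E.flatMap fun e => encodeUnary (page e).val) := by
      rw [List.flatMap_cons, takePage_encodeUnary]
      congr 1
      ext
      simp
    rw [check, ht, Bool.and_eq_true, List.all_eq_true]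
    refine ⟨fun f hf => by simpa using hQ e List.mem_cons_self f hf,
      ih _ (fun f hf g hg => h f (List.mem_cons_of_mem _ hf) g (List.mem_cons_of_mem _ hg))
        fun f hf g hg => ?_⟩
    by_cases hfe : page f = page e
    · rw [hfe, update_self] at hg
      rcases List.mem_cons.1 hg with rfl | hg
      · exact h f (List.mem_cons_of_mem _ hf) g List.mem_cons_self hfe
      · exact hQ f (List.mem_cons_of_mem _ hf) g (hfe ▸ hg)
    · rw [update_of_ne hfe] at hg
      exact hQ f (List.mem_cons_of_mem _ hf) g hg

theorem exists_isPaging_of_check (s q : ℕ) [NeZero (s + q)] {E : List (ℕ × ℕ)} (hE : E.Nodup)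
    {w : List Bool} (h : check (N := s + q) s E w (fun _ => []) = true) :
    ∃ page, IsPaging s q E page := by
  obtain ⟨page, hp, -⟩ := exists_page_of_check s hE w _ h
  refine ⟨fun e => (page e).val, fun e _ => (page e).2, fun e he f hf hef hc => ?_⟩
  have := hp e he f hf (Fin.ext hef)
  rw [clash, decide_eq_false_iff_not] at this
  exact this (Or.inl hc)

/-- A layout yields a certificate that is short and accepted. -/
theorem exists_check_of_isPaging {s q : ℕ} [NeZero (s + q)] {E : List (ℕ × ℕ)} {page : ℕ × ℕ → ℕ}
    (h : IsPaging s q E page) : ∃ w : List Bool, w.length ≤ (s + q) * E.length ∧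
      check (N := s + q) s E w (fun _ => []) = true := by
  obtain ⟨h₁, h₂⟩ := h
  let pg : ℕ × ℕ → Fin (s + q) := fun e => Fin.ofNat _ (page e)
  have hpg {e : ℕ × ℕ} (he : e ∈ E) : (pg e).val = page e := Nat.mod_eq_of_lt (h₁ e he)
  refine ⟨E.flatMap fun e => encodeUnary (pg e).val, ?_, check_of_page s E pg _ ?_ (by simp)⟩
  · have (l : List (ℕ × ℕ)) :
        (l.flatMap fun e => encodeUnary (pg e).val).length ≤ (s + q) * l.length := by
      induction l with
      | nil => simp
      | cons e l ih =>
        have := (pg e).2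
        rw [List.flatMap_cons, List.length_append, Reduction.length_encodeUnary,
          List.length_cons, Nat.mul_succ]
        omega
    exact this E
  · intro e he f hf hef
    have h : page e = page f := by rw [← hpg he, ← hpg hf, hef]
    have h₃ := h₂ e he f hf h
    have h₄ := h₂ f hf e he h.symm
    simp only [clash, hpg he, decide_eq_false_iff_not, not_or]
    exact ⟨h₃, h ▸ h₄⟩

end Verifier

open Verifier in
/-- The problem is in NP, if there is a page at all. -/
theorem inNP_fixedOrderMixedLayout (s q : ℕ) (h : 0 < s + q) :
    InNP OrderedGraph.encode (FixedOrderMixedLayout s q) := by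
  have : NeZero (s + q) := ⟨h.ne'⟩
  have hlen (I : OrderedGraph) : I.natEdges.length ≤ I.encode.length := by
    have := (length_encodeEntries_le I.natEdges).2
    rw [I.encode_eq, List.length_append]
    omega
  refine ⟨fun p => check (N := s + q) s p.1.natEdges p.2 fun _ => [],
    Polynomial.C (s + q) * Polynomial.X, ?_, fun I => ?_⟩
  · refine Prog.computable_toTM (p := Verifier.prog (N := s + q) s) (Γ := Alph (s + q))
      (k₀ := Stack.inp) (k₁ := Stack.out) (v := init) (Equiv.refl Sym) (Equiv.refl Bool)
      (3 * Polynomial.X + (Polynomial.X * (22 * Polynomial.X + 8) + 2) + (2 * Polynomial.X + 1) +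
        Polynomial.C (s + q) * (2 * Polynomial.X + 1)) fun p => ?_
    obtain ⟨I, w⟩ := p
    have hm : (encodeWithCertificate OrderedGraph.encode (I, w)).length =
        I.n + 1 + (I.natEdges.flatMap encodePair).length + 1 + w.length := by
      simp only [encodeWithCertificate, I.encode_eq, List.length_append, List.length_map,
        List.length_cons, Reduction.length_encodeUnary]
      omega
    have h₁ := runs_prog (N := s + q) s I.n I.natEdges w hm.ge
    rw [← I.encode_eq] at h₁
    have hid {X : Type} (l : List X) : l.map (Equiv.refl X).symm = l := List.map_id l
    rw [hid, hid]
    refine h₁.mono (le_of_eq ?_)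
    simp only [Polynomial.eval_add, Polynomial.eval_mul, Polynomial.eval_C, Polynomial.eval_X,
      Polynomial.eval_ofNat, Polynomial.eval_one]
  · simp only [fixedOrderMixedLayout_iff, Polynomial.eval_mul, Polynomial.eval_C,
      Polynomial.eval_X]
    constructor
    · rintro ⟨page, hp⟩
      obtain ⟨w, hw, hc⟩ := exists_check_of_isPaging hp
      exact ⟨w, hw.trans (Nat.mul_le_mul_left _ (hlen I)), hc⟩
    · rintro ⟨w, -, hc⟩
      exact exists_isPaging_of_check s q I.nodup_natEdges hc

/-! ### NP-completeness -/

theorem NPComplete.of_reducible {α β A B : Type} {ea : α → List A} {P : α → Prop}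
    {eb : β → List B} {Q : β → Prop} (h : NPComplete ea P) (hr : PolyTimeReducible ea P eb Q)
    (hQ : InNP eb Q) : NPComplete eb Q :=
  ⟨hQ, fun A hA => (h.2 A hA).trans hr⟩

theorem theorem2 (s q : ℕ)
    (h : NPComplete OrderedGraph.encode (FixedOrderMixedLayout s q)) :
    NPComplete OrderedGraph.encode (FixedOrderMixedLayout s (q + 1)) ∧
      NPComplete OrderedGraph.encode (FixedOrderMixedLayout (s + 1) q) := by
  exact ⟨h.of_reducible (polyTimeReducible_queue s q)
      (inNP_fixedOrderMixedLayout s (q + 1) (by omega)),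
    h.of_reducible (polyTimeReducible_stack s q)
      (inNP_fixedOrderMixedLayout (s + 1) q (by omega))⟩
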